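/- Setting. Let $n\ge 1$ be the number of workers, $N$ the dimension, $M\ge1$ the batch size, $K\ge 1$ the number of iterations, and let $p_1,\dots,p_n\ge 0$ with $\sum_i p_i=1$. Worker $i$ has a data distribution $\mathcal D_i$ and a sample loss $F_i(x;\xi)$, differentiable in $x\in\mathbb R^N$ (and measurable and $\mathcal D_i$-integrable in $\xi$). Put $f_i(x)=\mathbb E_{\xi\sim\mathcal D_i}F_i(x;\xi)$ and $f=\sum_{i=1}^n p_i f_i$, and assume that $f^*:=\inf_x f(x)>-\infty$. Gradients $\nabla F_i(x;\xi)$ are taken in $x$, and $\|\cdot\|$ is the Euclidean norm. Assumptions. 1. Every $f_i$ is differentiable with $L$-Lipschitz gradient ($L\ge0$). 2. For all $i$ and $x$: $\mathbb E_{\xi\sim\mathcal D_i}\nabla F_i(x;\xi)=\nabla f_i(x)$ and $\mathbb E_{\xi\sim\mathcal D_i}\|\nabla F_i(x;\xi)-\nabla f_i(x)\|^2\le\sigma^2$; and for all $x$: $\sum_{i=1}^n p_i\|\nabla f_i(x)-\nabla f(x)\|^2\le\varsigma^2$. 3. At step $k=0,1,2,\dots$ a worker $i_k$ with $\mathbb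 P(i_k=i)=p_i$, a random $n\times n$ matrix $W_k$, and samples $\xi_k=(\xi_{k,m}^{i})_{1\le i\le n,\,1\le m\le M}$ with $\xi_{k,m}^i\sim\mathcal D_i$ are drawn. The variables $i_k$ and $\xi_{k,m}^i$ ($k\ge0$, $1\le i\le n$, $1\le m\le M$) are all independent. $W_k$ may depend on $i_k$ (and on $\xi_k$), and the triples $(i_k,W_k,\xi_k)$, $k\ge 0$, are independent of each other. 4. $W_k$ is almost surely doubly stochastic, and there is a $\rho\in[0,1)$ such that, if $n\ge2$, $\max\{|\lambda_2(\mathbb E[W_k^\top W_k])|,|\lambda_n(\mathbb E[W_k^\top W_k])|\}\le\rho$ for all $k$, where $\lambda_j(\cdot)$ is the $j$-th largest eigenvalue (for $n=1$ this is no condition). 5. The delays are deterministic integers $\tau_k$ with $0\le\tau_k\le k$ and $\tau_k\le T$ for all $k$, where $T$ is a nonnegative integer. 6. The initial model $x_0\in\mathbb R^N$ is deterministic, or random and independent of $(i_k,W_k,\xi_k)_{k\ge0}$ with $\mathbb E|f(x_0)|<\infty$. Algorithm (AD-PSGD). With step size $\gamma>0$, let $X_k=[x_k^1,\dots,x_k^n]\in\mathbb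 R^{N\times n}$ be defined by $X_0=[x_0,\dots,x_0]$ and $$X_{k+1}=X_kW_k-\gamma\,\partial g(X_{k-\tau_k};\xi_k,i_k),$$ where $\partial g(X_{k-\tau_k};\xi_k,i_k)\in\mathbb R^{N\times n}$ has $i_k$-th column $\sum_{m=1}^M\nabla F_{i_k}(x_{k-\tau_k}^{i_k};\xi_{k,m}^{i_k})$ and all other columns zero. Let $\mathbf 1_n\in\mathbb R^n$ be the all-ones vector, so that $X_k\mathbf 1_n/n$ is the mean of the local models. Constants. Put $$\bar\rho=\frac{n-1}{n}\Big(\frac1{1-\rho}+\frac{2\sqrt\rho}{(1-\sqrt\rho)^2}\Big),\qquad C_1=1-24M^2L^2\gamma^2\Big(T\frac{n-1}{n}+\bar\rho\Big),$$ $$C_2=\frac{\gamma M}{2n}-\frac{\gamma^2LM^2}{n^2}-\frac{2M^3L^2T^2\gamma^3}{n^3}-\Big(\frac{6\gamma^2L^3M^2}{n^2}+\frac{\gamma M}{n}L^2+\frac{12M^3L^4T^2\gamma^3}{n^3}\Big)\frac{4M^2\gamma^2\big(T\frac{n-1}{n}+\bar\rho\big)}{C_1},$$ $$C_3=\frac12+\frac{2\big(6\gamma^2L^2M^2+\gamma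 nML+\frac{12M^3L^3T^2\gamma^3}{n}\big)\bar\rho}{C_1}+\frac{LT^2\gamma M}{n}.$$ Theorem. If $C_1>0$, $C_2\ge0$ and $C_3\le1$, then $\mathbb E\big\|\nabla f(X_k\mathbf 1_n/n)\big\|^2<\infty$ for all $k$, and $$\frac1K\sum_{k=0}^{K-1}\mathbb E\Big\|\nabla f\Big(\frac{X_k\mathbf 1_n}{n}\Big)\Big\|^2\le\frac{2n\,(\mathbb E f(x_0)-f^*)}{\gamma KM}+\frac{2\gamma L}{n}\big(\sigma^2+6M\varsigma^2\big).$$ -/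

import Mathlib

open MeasureTheory ProbabilityTheory
open scoped Gradient NNReal

noncomputable section

namespace ADPSGD

/-! ### The optimization problem -/

/-- Local loss `f_i(x) = E_{ξ ∼ D_i} F_i(x; ξ)`. -/
def localLoss {n N : ℕ} {Ξ : Type*} [MeasurableSpace Ξ]
    (F : Fin n → EuclideanSpace ℝ (Fin N) → Ξ → ℝ) (D : Fin n → Measure Ξ)
    (i : Fin n) (x : EuclideanSpace ℝ (Fin N)) : ℝ :=
  ∫ ξ, F i x ξ ∂(D i)

/-- Global loss `f(x) = ∑ i, p_i f_i(x)`. -/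
def globalLoss {n N : ℕ} {Ξ : Type*} [MeasurableSpace Ξ] (p : Fin n → ℝ)
    (F : Fin n → EuclideanSpace ℝ (Fin N) → Ξ → ℝ) (D : Fin n → Measure Ξ)
    (x : EuclideanSpace ℝ (Fin N)) : ℝ :=
  ∑ i, p i * localLoss F D i x

/-- Stochastic gradient `∇F_i(x; ξ)`, the gradient being taken in `x`. -/
def stochGrad {n N : ℕ} {Ξ : Type*} (F : Fin n → EuclideanSpace ℝ (Fin N) → Ξ → ℝ)
    (i : Fin n) (x : EuclideanSpace ℝ (Fin N)) (ξ : Ξ) : EuclideanSpace ℝ (Fin N) :=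
  ∇ (fun y => F i y ξ) x

/-! ### The iteration -/

/-- One realization of the AD-PSGD iteration `X_{k+1} = X_k W_k - γ ∂g(X_{k-τ_k}; ξ_k, i_k)`, started
from `X_0 = [x₀, …, x₀]`. A matrix `X_k` of size `N × n` is represented by its columns, the local
models `x_k^1, …, x_k^n`; the only nonzero column of `∂g` is the one of index `i_k`, which is the
sum of `M` stochastic gradients of worker `i_k` at its stale local model. -/
def iterate {n N M : ℕ} {Ξ : Type*} (F : Fin n → EuclideanSpace ℝ (Fin N) → Ξ → ℝ) (γ : ℝ)
    (τ : ℕ → ℕ) (x₀ : EuclideanSpace ℝ (Fin N)) (w : ℕ → Fin n)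
    (W : ℕ → Matrix (Fin n) (Fin n) ℝ) (ξ : ℕ → Fin n → Fin M → Ξ) :
    ℕ → Fin n → EuclideanSpace ℝ (Fin N)
  | 0 => fun _ => x₀
  | k + 1 => fun i =>
      (∑ j, W k j i • iterate F γ τ x₀ w W ξ k j) -
        γ • (if i = w k then
              ∑ m, stochGrad F i (iterate F γ τ x₀ w W ξ (k - τ k) i) (ξ k i m)
            else 0)
termination_by k => k
decreasing_by all_goals omega

/-- The mean model `X 1_n / n`. -/
def meanModel {n N : ℕ} (X : Fin n → EuclideanSpace ℝ (Fin N)) : EuclideanSpace ℝ (Fin N) :=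
  (n : ℝ)⁻¹ • ∑ i, X i

/-! ### The spectral gap -/

/-- The entrywise expectation `E[Wᵀ W]` of a random matrix `W`. -/
def expGram {n : ℕ} {Ω : Type*} [MeasurableSpace Ω] (P : Measure Ω)
    (W : Ω → Matrix (Fin n) (Fin n) ℝ) : Matrix (Fin n) (Fin n) ℝ :=
  Matrix.of fun a b => ∫ ω, ((W ω).transpose * W ω) a b ∂P

theorem expGram_isHermitian {n : ℕ} {Ω : Type*} [MeasurableSpace Ω] (P : Measure Ω)
    (W : Ω → Matrix (Fin n) (Fin n) ℝ) : (expGram P W).IsHermitian := by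
  ext a b
  simp only [expGram, Matrix.conjTranspose_apply, Matrix.of_apply, star_trivial]
  congr 1
  ext ω
  simp only [Matrix.mul_apply, Matrix.transpose_apply]
  exact Finset.sum_congr rfl fun c _ => mul_comm _ _

/-- The eigenvalues of a real symmetric `n × n` matrix in decreasing order: in the usual 1-based
numbering, `sortedEigenvalue hA j` is `λ_{j+1}(A)`. -/
def sortedEigenvalue {n : ℕ} {A : Matrix (Fin n) (Fin n) ℝ} (hA : A.IsHermitian) (j : Fin n) : ℝ :=
  hA.eigenvalues₀ (Fin.cast (Fintype.card_fin n).symm j)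

/-- `max {|λ_2(E[Wᵀ W])|, |λ_n(E[Wᵀ W])|} ≤ ρ`; for `n = 1`, where there is no second eigenvalue,
the condition is void. -/
def SpectralGap {n : ℕ} {Ω : Type*} [MeasurableSpace Ω] (P : Measure Ω)
    (W : Ω → Matrix (Fin n) (Fin n) ℝ) (ρ : ℝ) : Prop :=
  ∀ hn : 2 ≤ n,
    max |sortedEigenvalue (expGram_isHermitian P W) ⟨1, by omega⟩|
      |sortedEigenvalue (expGram_isHermitian P W) ⟨n - 1, by omega⟩| ≤ ρ

/-! ### Standing assumptions -/

/-- Assumptions on the weights `p`, the sample losses `F`, the data distributions `D`, with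
smoothness constant `L` and variance bounds `σ²` and `ς²`. -/
structure LossAssumptions {n N : ℕ} {Ξ : Type*} [MeasurableSpace Ξ] (p : Fin n → ℝ)
    (F : Fin n → EuclideanSpace ℝ (Fin N) → Ξ → ℝ) (D : Fin n → Measure Ξ)
    (L : ℝ≥0) (σ ς : ℝ) : Prop where
  weight_nonneg : ∀ i, 0 ≤ p i
  weight_sum : ∑ i, p i = 1
  isProbabilityMeasure : ∀ i, IsProbabilityMeasure (D i)
  measurable_loss : ∀ i x, Measurable (F i x)
  integrable_loss : ∀ i x, Integrable (F i x) (D i)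
  differentiable_loss : ∀ i ξ, Differentiable ℝ fun x => F i x ξ
  differentiable_localLoss : ∀ i, Differentiable ℝ (localLoss F D i)
  lipschitz_grad : ∀ i, LipschitzWith L (∇ (localLoss F D i))
  unbiased : ∀ i x, ∫ ξ, stochGrad F i x ξ ∂(D i) = ∇ (localLoss F D i) x
  integrable_variance : ∀ i x,
    Integrable (fun ξ => ‖stochGrad F i x ξ - ∇ (localLoss F D i) x‖ ^ 2) (D i)
  variance_le : ∀ i x,
    ∫ ξ, ‖stochGrad F i x ξ - ∇ (localLoss F D i) x‖ ^ 2 ∂(D i) ≤ σ ^ 2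
  worker_variance_le : ∀ x,
    ∑ i, p i * ‖∇ (localLoss F D i) x - ∇ (globalLoss p F D) x‖ ^ 2 ≤ ς ^ 2
  bddBelow : BddBelow (Set.range (globalLoss p F D))

/-- Assumptions on the random quantities that drive the iteration: the initial model `x₀`, the
workers `w k`, the averaging matrices `W k`, and the samples `ξ k i m` (the `m`-th sample from
the data of worker `i` at step `k`; at step `k` only those of the worker `w k` are used). The matrix
`W k` may depend on the other random quantities of step `k`. -/
structure SamplingAssumptions {n N M : ℕ} {Ξ Ω : Type*} [MeasurableSpace Ξ] [MeasurableSpace Ω]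
    (P : Measure Ω) (p : Fin n → ℝ) (D : Fin n → Measure Ξ) (ρ : ℝ)
    (x₀ : Ω → EuclideanSpace ℝ (Fin N)) (w : ℕ → Ω → Fin n)
    (W : ℕ → Ω → Matrix (Fin n) (Fin n) ℝ) (ξ : ℕ → Ω → Fin n → Fin M → Ξ) : Prop where
  measurable_init : Measurable x₀
  measurable_worker : ∀ k, Measurable (w k)
  measurable_matrix : ∀ k i j, Measurable fun ω => W k ω i j
  measurable_sample : ∀ k, Measurable (ξ k)
  law_worker : ∀ k i, P.real {ω | w k ω = i} = p i
  law_sample : ∀ k i m, P.map (fun ω => ξ k ω i m) = D i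
  doublyStochastic : ∀ k, ∀ᵐ ω ∂P, W k ω ∈ doublyStochastic ℝ (Fin n)
  spectralGap : ∀ k, SpectralGap P (W k) ρ
  /-- Different steps are independent. -/
  indep_steps : iIndepFun
    (fun k ω => ((w k ω, fun i j => W k ω i j, ξ k ω) :
      Fin n × (Fin n → Fin n → ℝ) × (Fin n → Fin M → Ξ))) P
  /-- Within a step, the samples are independent of the worker. -/
  indep_worker_sample : ∀ k, IndepFun (w k) (ξ k) P
  /-- Within a step, the samples are independent of each other. -/
  indep_samples : ∀ k, iIndepFun (fun (q : Fin n × Fin M) ω => ξ k ω q.1 q.2) P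
  /-- The initial model is independent of everything sampled later. -/
  indep_init : IndepFun x₀
    (fun ω k => ((w k ω, fun i j => W k ω i j, ξ k ω) :
      Fin n × (Fin n → Fin n → ℝ) × (Fin n → Fin M → Ξ))) P

/-! ### The constants -/

/-- `ρ̄`. -/
def rhoBar (n : ℕ) (ρ : ℝ) : ℝ :=
  ((n : ℝ) - 1) / n * (1 / (1 - ρ) + 2 * √ρ / (1 - √ρ) ^ 2)

/-- `C₁`. -/
def C₁ (n M T : ℕ) (L γ ρ : ℝ) : ℝ :=
  1 - 24 * (M : ℝ) ^ 2 * L ^ 2 * γ ^ 2 * (T * (((n : ℝ) - 1) / n) + rhoBar n ρ)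

/-- `C₂`. -/
def C₂ (n M T : ℕ) (L γ ρ : ℝ) : ℝ :=
  γ * M / (2 * n) - γ ^ 2 * L * (M : ℝ) ^ 2 / (n : ℝ) ^ 2
    - 2 * (M : ℝ) ^ 3 * L ^ 2 * (T : ℝ) ^ 2 * γ ^ 3 / (n : ℝ) ^ 3
    - (6 * γ ^ 2 * L ^ 3 * (M : ℝ) ^ 2 / (n : ℝ) ^ 2 + γ * M / n * L ^ 2
        + 12 * (M : ℝ) ^ 3 * L ^ 4 * (T : ℝ) ^ 2 * γ ^ 3 / (n : ℝ) ^ 3)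
      * (4 * (M : ℝ) ^ 2 * γ ^ 2 * (T * (((n : ℝ) - 1) / n) + rhoBar n ρ) / C₁ n M T L γ ρ)

/-- `C₃`. -/
def C₃ (n M T : ℕ) (L γ ρ : ℝ) : ℝ :=
  1 / 2
    + 2 * (C₁ n M T L γ ρ)⁻¹
      * (6 * γ ^ 2 * L ^ 2 * (M : ℝ) ^ 2 + γ * n * M * L
          + 12 * (M : ℝ) ^ 3 * L ^ 3 * (T : ℝ) ^ 2 * γ ^ 3 / n)
      * rhoBar n ρ
    + L * (T : ℝ) ^ 2 * γ * M / n

end ADPSGD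

end

noncomputable section

namespace ADPSGD

/-! ### Smooth functions -/

section Smooth

variable {E : Type*} [NormedAddCommGroup E] [InnerProductSpace ℝ E] [CompleteSpace E]

/-! Averaging by a doubly stochastic matrix preserves the mean of the local models, so the mean
follows stochastic gradient descent with step `γ / n`, but with gradients taken at stale local
models. Summed over the `K` steps and in expectation, let `A` be the squared gradient of the loss at
the mean, `B` the squared norm of the weighted sum of the local gradients at the stale models, `Q`
the weighted deviation of the stale models from their own mean, `d` the squared drift of the mean
during the delay, and `G` the squared norm of the updates.

Smoothness and conditional unbiasedness (`Run.integral_descent`) bound `γM/(2n) * (A + B)` by the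
decrease of the loss plus `γM/n * L² * (d + Q)` and `Lγ²/(2n²) * G`. Three more estimates close the
system. Cauchy–Schwarz over at most `T` updates bounds `d` by `γ²T²/n² * G`. Independence inside a
minibatch gives `G ≤ S + M²(2L²Q + B)`, with `S` the accumulated noise. For `Q`, unrolling the
recursion (`Run.sum_smul_X`) writes a local model minus the mean as a sum of past updates, each
weighted by an entry of a product of later averaging matrices applied to a vector of sum zero. That
product is independent of the update and contracts by `ρ` per factor in mean square, so `Q` is
bounded by a sum of the update moments, geometrically discounted with ratio `√ρ`
(`Run.integral_deviation_le`).

Both `G` and `Q` feed back into each other and into `B`. The conditions on the constants make the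
feedback small enough to be absorbed by the term `-B` of the descent inequality; this is the purely
real computation `sum_sq_gradient_le_of_bounds`. The delay multiplies only the feedback part of the
bound on `Q`, not the noise `S`, so the noise coefficient is controlled by `rhoBar` alone.

The initial model need not be square integrable. Moments are therefore taken of differences from it,
and its gradient is controlled by the loss through `norm_gradient_sq_le`. -/

theorem lipschitz_gradient_upper_bound {f : E → ℝ} {L : ℝ≥0} (hf : Differentiable ℝ f)
    (hL : LipschitzWith L (∇ f)) (x d : E) :
    f (x + d) ≤ f x + inner ℝ (∇ f x) d + L / 2 * ‖d‖ ^ 2 := by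
  -- The loss along the segment minus the non-constant part of its quadratic majorant; the claim is
  -- `φ 1 ≤ φ 0`.
  set φ : ℝ → ℝ := fun t => f (x + t • d) - t * inner ℝ (∇ f x) d - L / 2 * ‖d‖ ^ 2 * t ^ 2
  have hφ : ∀ t, HasDerivAt φ
      (inner ℝ (∇ f (x + t • d)) d - inner ℝ (∇ f x) d - L * ‖d‖ ^ 2 * t) t := by
    intro t
    have h1 : HasDerivAt (fun t : ℝ => x + t • d) d t := by
      simpa using ((hasDerivAt_id t).smul_const d).const_add x
    have h2 : HasDerivAt (fun t : ℝ => f (x + t • d)) (inner ℝ (∇ f (x + t • d)) d) t := by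
      have := (hf (x + t • d)).hasFDerivAt.comp_hasDerivAt t h1
      rwa [← inner_gradient_left] at this
    have h3 := (h2.sub ((hasDerivAt_id t).mul_const (inner ℝ (∇ f x) d))).sub
      ((hasDerivAt_pow 2 t).const_mul ((L : ℝ) / 2 * ‖d‖ ^ 2))
    refine h3.congr_deriv ?_
    push_cast
    ring
  have hanti : AntitoneOn φ (Set.Icc 0 1) := by
    refine antitoneOn_of_deriv_nonpos (convex_Icc 0 1)
      (fun t _ => (hφ t).continuousAt.continuousWithinAt)
      (fun t _ => (hφ t).differentiableAt.differentiableWithinAt) fun t ht => ?_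
    rw [interior_Icc] at ht
    rw [(hφ t).deriv, ← inner_sub_left]
    have h1 := real_inner_le_norm (∇ f (x + t • d) - ∇ f x) d
    have h2 := hL.dist_le_mul (x + t • d) x
    rw [dist_eq_norm, dist_eq_norm, add_sub_cancel_left, norm_smul, Real.norm_of_nonneg ht.1.le]
      at h2
    nlinarith [norm_nonneg d, mul_le_mul_of_nonneg_right h2 (norm_nonneg d)]
  have := hanti (Set.left_mem_Icc.2 zero_le_one) (Set.right_mem_Icc.2 zero_le_one) zero_le_one
  simp only [φ, one_smul, zero_smul, add_zero] at this
  linarith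

/-- A gradient step of size `1 / (L + 1)` lowers `f` by at least `‖∇ f x‖² / (2(L + 1))` and cannot
go below `m`. Using `L + 1` instead of `L` covers `L = 0`. -/
theorem norm_gradient_sq_le {f : E → ℝ} {L : ℝ≥0} (hf : Differentiable ℝ f)
    (hL : LipschitzWith L (∇ f)) {m : ℝ} (hm : ∀ x, m ≤ f x) (x : E) :
    ‖∇ f x‖ ^ 2 ≤ 2 * (L + 1) * (f x - m) := by
  have h := lipschitz_gradient_upper_bound hf (hL.weaken (le_add_of_nonneg_right zero_le_one)) x
    (-((L : ℝ) + 1)⁻¹ • ∇ f x)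
  have h' := hm (x + -((L : ℝ) + 1)⁻¹ • ∇ f x)
  have hpos : (0 : ℝ) < (L : ℝ) + 1 := by positivity
  rw [inner_smul_right, real_inner_self_eq_norm_sq, norm_smul, mul_pow, Real.norm_eq_abs, sq_abs]
    at h
  push_cast at h
  have h3 : m ≤ f x - ‖∇ f x‖ ^ 2 / (2 * (L + 1)) := by
    refine (h'.trans h).trans (le_of_eq ?_)
    field_simp
    ring
  have h4 : ‖∇ f x‖ ^ 2 / (2 * (L + 1)) ≤ f x - m := by linarith
  rw [div_le_iff₀ (by positivity)] at h4
  linarith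

end Smooth

/-! ### Weighted means of vectors -/

section WeightedMean

theorem norm_add_sq_le_two {E : Type*} [NormedAddCommGroup E] (a b : E) :
    ‖a + b‖ ^ 2 ≤ 2 * ‖a‖ ^ 2 + 2 * ‖b‖ ^ 2 := by
  have := norm_add_le a b
  nlinarith [norm_nonneg (a + b), norm_nonneg a, norm_nonneg b, sq_nonneg (‖a‖ - ‖b‖)]

variable {E ι : Type*} [NormedAddCommGroup E] [InnerProductSpace ℝ E] [Fintype ι]

/-- Bias–variance decomposition around an arbitrary centre. Jensen's inequality (centre at the mean)
and `sum_weight_norm_sq_le` follow by dropping one nonnegative term. -/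
theorem sum_weight_norm_sub_sq {p : ι → ℝ} (hp1 : ∑ i, p i = 1) (y : ι → E) (c : E) :
    ∑ i, p i * ‖y i - c‖ ^ 2 =
      ∑ i, p i * ‖y i‖ ^ 2 - ‖∑ i, p i • y i‖ ^ 2 + ‖∑ i, p i • y i - c‖ ^ 2 := by
  have h1 : ∀ i, p i * ‖y i - c‖ ^ 2 =
      p i * ‖y i‖ ^ 2 - 2 * inner ℝ (p i • y i) c + p i * ‖c‖ ^ 2 := by
    intro i
    rw [norm_sub_sq_real, inner_smul_left]
    simp
    ring
  rw [Finset.sum_congr rfl fun i _ => h1 i, Finset.sum_add_distrib, Finset.sum_sub_distrib,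
    ← Finset.mul_sum, ← sum_inner, ← Finset.sum_mul, hp1, norm_sub_sq_real]
  ring

theorem norm_sum_weight_smul_sq_le {p : ι → ℝ} (hp0 : ∀ i, 0 ≤ p i) (hp1 : ∑ i, p i = 1)
    (y : ι → E) : ‖∑ i, p i • y i‖ ^ 2 ≤ ∑ i, p i * ‖y i‖ ^ 2 := by
  have h := sum_weight_norm_sub_sq hp1 y (∑ i, p i • y i)
  have h0 : 0 ≤ ∑ i, p i * ‖y i - ∑ i, p i • y i‖ ^ 2 :=
    Finset.sum_nonneg fun i _ => mul_nonneg (hp0 i) (sq_nonneg _)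
  simp only [sub_self, norm_zero] at h
  linarith

theorem sum_weight_norm_sq_le {p : ι → ℝ} (hp1 : ∑ i, p i = 1)
    (y : ι → E) (c : E) :
    ∑ i, p i * ‖y i‖ ^ 2 ≤ ‖∑ i, p i • y i‖ ^ 2 + ∑ i, p i * ‖y i - c‖ ^ 2 := by
  rw [sum_weight_norm_sub_sq hp1 y c]
  linarith [sq_nonneg ‖∑ i, p i • y i - c‖]

end WeightedMean

/-! ### The loss functions -/

section Loss

variable {n N : ℕ} {Ξ : Type*} [MeasurableSpace Ξ] {p : Fin n → ℝ}
  {F : Fin n → EuclideanSpace ℝ (Fin N) → Ξ → ℝ} {D : Fin n → Measure Ξ} {L : ℝ≥0} {σ ς : ℝ}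

namespace LossAssumptions

theorem hasGradientAt_globalLoss (h : LossAssumptions p F D L σ ς)
    (x : EuclideanSpace ℝ (Fin N)) :
    HasGradientAt (globalLoss p F D) (∑ i, p i • ∇ (localLoss F D i) x) x := by
  rw [hasGradientAt_iff_hasFDerivAt, map_sum]
  unfold globalLoss
  refine HasFDerivAt.fun_sum fun i _ => ?_
  rw [map_smul]
  exact (h.differentiable_localLoss i x).hasGradientAt.hasFDerivAt.const_mul (p i)

theorem gradient_globalLoss (h : LossAssumptions p F D L σ ς) (x : EuclideanSpace ℝ (Fin N)) :
    ∇ (globalLoss p F D) x = ∑ i, p i • ∇ (localLoss F D i) x :=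
  (h.hasGradientAt_globalLoss x).gradient

theorem differentiable_globalLoss (h : LossAssumptions p F D L σ ς) :
    Differentiable ℝ (globalLoss p F D) :=
  fun x => (h.hasGradientAt_globalLoss x).differentiableAt

theorem norm_gradient_sub_sq_le (h : LossAssumptions p F D L σ ς) (i : Fin n)
    (x y : EuclideanSpace ℝ (Fin N)) :
    ‖∇ (localLoss F D i) x - ∇ (localLoss F D i) y‖ ^ 2 ≤ L ^ 2 * ‖x - y‖ ^ 2 := by
  have := (h.lipschitz_grad i).norm_sub_le x y
  rw [← mul_pow]
  exact pow_le_pow_left₀ (norm_nonneg _) this 2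

theorem lipschitz_gradient_globalLoss (h : LossAssumptions p F D L σ ς) :
    LipschitzWith L (∇ (globalLoss p F D)) := by
  refine LipschitzWith.of_dist_le_mul fun x y => ?_
  rw [dist_eq_norm, dist_eq_norm, h.gradient_globalLoss, h.gradient_globalLoss,
    ← Finset.sum_sub_distrib]
  calc ‖∑ i, (p i • ∇ (localLoss F D i) x - p i • ∇ (localLoss F D i) y)‖
      ≤ ∑ i, p i * (L * ‖x - y‖) := by
        refine norm_sum_le_of_le _ fun i _ => ?_
        rw [← smul_sub, norm_smul, Real.norm_of_nonneg (h.weight_nonneg i)]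
        exact mul_le_mul_of_nonneg_left ((h.lipschitz_grad i).norm_sub_le x y)
          (h.weight_nonneg i)
    _ = L * ‖x - y‖ := by rw [← Finset.sum_mul, h.weight_sum, one_mul]

theorem norm_gradient_globalLoss_sub_sq_le (h : LossAssumptions p F D L σ ς)
    (x y : EuclideanSpace ℝ (Fin N)) :
    ‖∇ (globalLoss p F D) x - ∇ (globalLoss p F D) y‖ ^ 2 ≤ L ^ 2 * ‖x - y‖ ^ 2 := by
  have := h.lipschitz_gradient_globalLoss.norm_sub_le x y
  rw [← mul_pow]
  exact pow_le_pow_left₀ (norm_nonneg _) this 2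

/-- Second moment of the local gradients at different points `y i`, compared with a common
point `c`. -/
theorem sum_weight_norm_gradient_sq_le (h : LossAssumptions p F D L σ ς)
    (y : Fin n → EuclideanSpace ℝ (Fin N)) (c : EuclideanSpace ℝ (Fin N)) :
    ∑ i, p i * ‖∇ (localLoss F D i) (y i)‖ ^ 2 ≤
      ‖∑ i, p i • ∇ (localLoss F D i) (y i)‖ ^ 2 + 2 * L ^ 2 * ∑ i, p i * ‖y i - c‖ ^ 2
        + 2 * ς ^ 2 := by
  -- Comparing with a fixed vector keeps the coefficient of the squared mean equal to 1; that term
  -- must later be absorbed by the descent inequality.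
  refine (sum_weight_norm_sq_le h.weight_sum _ (∇ (globalLoss p F D) c)).trans ?_
  have h1 : ∀ i, p i * ‖∇ (localLoss F D i) (y i) - ∇ (globalLoss p F D) c‖ ^ 2 ≤
      2 * L ^ 2 * (p i * ‖y i - c‖ ^ 2) +
        2 * (p i * ‖∇ (localLoss F D i) c - ∇ (globalLoss p F D) c‖ ^ 2) := by
    intro i
    have h2 := norm_add_sq_le_two (∇ (localLoss F D i) (y i) - ∇ (localLoss F D i) c)
      (∇ (localLoss F D i) c - ∇ (globalLoss p F D) c)
    rw [sub_add_sub_cancel] at h2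
    have h3 := h.norm_gradient_sub_sq_le i (y i) c
    have := mul_le_mul_of_nonneg_left (h2.trans (add_le_add_left
      (mul_le_mul_of_nonneg_left h3 zero_le_two) _)) (h.weight_nonneg i)
    linarith
  have h2 := Finset.sum_le_sum fun i (_ : i ∈ Finset.univ) => h1 i
  rw [Finset.sum_add_distrib, ← Finset.mul_sum, ← Finset.mul_sum] at h2
  linarith [h.worker_variance_le c]

/-- Bias of the mean of the local gradients at different points `y i` as an estimate of the
gradient of the global loss at `x`. -/
theorem norm_gradient_globalLoss_sub_sum_sq_le (h : LossAssumptions p F D L σ ς)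
    (y : Fin n → EuclideanSpace ℝ (Fin N)) (x c : EuclideanSpace ℝ (Fin N)) :
    ‖∇ (globalLoss p F D) x - ∑ i, p i • ∇ (localLoss F D i) (y i)‖ ^ 2 ≤
      2 * L ^ 2 * ‖x - c‖ ^ 2 + 2 * L ^ 2 * ∑ i, p i * ‖y i - c‖ ^ 2 := by
  have h2 := norm_add_sq_le_two (∇ (globalLoss p F D) x - ∇ (globalLoss p F D) c)
    (∇ (globalLoss p F D) c - ∑ i, p i • ∇ (localLoss F D i) (y i))
  rw [sub_add_sub_cancel] at h2
  have h3 := h.norm_gradient_globalLoss_sub_sq_le x c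
  have h4 : ‖∇ (globalLoss p F D) c - ∑ i, p i • ∇ (localLoss F D i) (y i)‖ ^ 2 ≤
      L ^ 2 * ∑ i, p i * ‖y i - c‖ ^ 2 := by
    rw [h.gradient_globalLoss c, ← Finset.sum_sub_distrib]
    simp_rw [← smul_sub]
    refine (norm_sum_weight_smul_sq_le h.weight_nonneg h.weight_sum _).trans ?_
    rw [Finset.mul_sum]
    refine Finset.sum_le_sum fun i _ => ?_
    rw [mul_left_comm, norm_sub_rev (y i) c]
    exact mul_le_mul_of_nonneg_left (h.norm_gradient_sub_sq_le i c (y i)) (h.weight_nonneg i)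
  linarith

end LossAssumptions

end Loss

/-! ### Quadratic forms and the spectral gap -/

section Spectral

open Matrix

variable {n : ℕ}

/-- A symmetric matrix that fixes the all-ones vector and whose second largest eigenvalue is at most
`ρ < 1` is bounded by `ρ` as a quadratic form on the vectors of sum zero. -/
theorem sum_mul_mul_le_of_sortedEigenvalue_le {A : Matrix (Fin n) (Fin n) ℝ} (hA : A.IsHermitian)
    (hn : 2 ≤ n) {ρ : ℝ} (hρ : ρ < 1) (hgap : sortedEigenvalue hA ⟨1, by omega⟩ ≤ ρ)
    (hone : A *ᵥ 1 = 1) {v : Fin n → ℝ} (hv : ∑ i, v i = 0) :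
    ∑ a, ∑ b, v a * (A a b * v b) ≤ ρ * ∑ a, v a ^ 2 := by
  set T := Matrix.toEuclideanLin A with hT
  have hTs : T.IsSymmetric := isSymmetric_toEuclideanLin_iff.mpr hA
  set bas := hTs.eigenvectorBasis finrank_euclideanSpace
  set ev := hTs.eigenvalues finrank_euclideanSpace
  have hTbas : ∀ j, T (bas j) = ev j • bas j := fun j => by
    exact hTs.apply_eigenvectorBasis finrank_euclideanSpace j
  have hevA : ∀ j, ev j = hA.eigenvalues₀ j := fun j => rfl
  have hcard : Fintype.card (Fin n) = n := Fintype.card_fin n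
  have hle : ∀ j : Fin (Fintype.card (Fin n)), j.val ≠ 0 → ev j ≤ ρ := by
    intro j hj
    refine le_trans ?_ hgap
    rw [hevA, sortedEigenvalue]
    apply hA.eigenvalues₀_antitone
    rw [Fin.le_def]
    simpa using Nat.one_le_iff_ne_zero.2 hj
  set e : EuclideanSpace ℝ (Fin n) := WithLp.toLp 2 1 with he
  set x : EuclideanSpace ℝ (Fin n) := WithLp.toLp 2 v with hx
  have hTe : T e = e := by
    rw [hT, he, Matrix.toLpLin_apply]
    simp [hone]
  have hcoef : ∀ y j, inner ℝ (bas j) (T y) = ev j * inner ℝ (bas j) y := by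
    intro y j
    rw [← hTs (bas j) y, hTbas, inner_smul_left]
    simp
  -- The all-ones vector has eigenvalue 1, and every eigenvalue but the first is at most `ρ < 1`;
  -- eigenvectors to different eigenvalues are orthogonal.
  have he0 : ∀ j, j.val ≠ 0 → inner ℝ (bas j) e = 0 := by
    intro j hj
    have h1 := hcoef e j
    rw [hTe] at h1
    have h2 : (1 - ev j) * inner ℝ (bas j) e = 0 := by linarith
    rcases mul_eq_zero.1 h2 with h3 | h3
    · linarith [hle j hj]
    · exact h3
  have hex : inner ℝ e x = 0 := by
    simp [he, hx, PiLp.inner_apply, hv]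
  have hee : inner ℝ e e = (n : ℝ) := by
    rw [he, PiLp.inner_apply]
    simp
  let j0 : Fin (Fintype.card (Fin n)) := ⟨0, by omega⟩
  have hj0 : ∀ j, j ≠ j0 → j.val ≠ 0 := fun j hj h => hj (Fin.ext h)
  -- The all-ones vector is thus a multiple of `bas j0`, so a vector of sum zero has no component
  -- there.
  have hsum : ∀ y, inner ℝ e y = inner ℝ (bas j0) e * inner ℝ (bas j0) y := by
    intro y
    rw [← bas.sum_inner_mul_inner e y, Finset.sum_eq_single j0]
    · rw [real_inner_comm]
    · intro j _ hj
      rw [real_inner_comm, he0 j (hj0 j hj), zero_mul]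
    · simp
  have hx0 : inner ℝ (bas j0) x = 0 := by
    have h1 := hsum x
    have h2 := hsum e
    rw [hex] at h1
    rw [hee] at h2
    rcases mul_eq_zero.1 h1.symm with h3 | h3
    · rw [h3, zero_mul] at h2
      have : (0 : ℝ) < n := by exact_mod_cast (by omega : 0 < n)
      linarith
    · exact h3
  have hq : inner ℝ x (T x) ≤ ρ * inner ℝ x x := by
    rw [← bas.sum_inner_mul_inner x (T x), ← bas.sum_inner_mul_inner x x, Finset.mul_sum]
    refine Finset.sum_le_sum fun j _ => ?_
    rw [hcoef, real_inner_comm]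
    by_cases hj : j = j0
    · rw [hj, hx0]; simp
    · nlinarith [hle j (hj0 j hj), mul_self_nonneg (inner ℝ (bas j) x : ℝ)]
  have h1 : inner ℝ x (T x) = ∑ a, ∑ b, v a * (A a b * v b) := by
    rw [PiLp.inner_apply]
    refine Finset.sum_congr rfl fun a _ => ?_
    have h3 : (T x) a = ∑ b, A a b * v b := by
      rw [hT, hx, Matrix.toLpLin_apply]
      rfl
    rw [h3, ← Finset.mul_sum]
    simp [hx, mul_comm]
  have h2 : inner ℝ x x = ∑ a, v a ^ 2 := by
    rw [hx, PiLp.inner_apply]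
    exact Finset.sum_congr rfl fun a _ => by simp [sq]
  rw [h1, h2] at hq
  exact hq

end Spectral

/-! ### Independence -/

section Independence

variable {Ω : Type*} {mΩ : MeasurableSpace Ω} {P : Measure Ω}

/-- On intersections `s ∩ t`, a π-system generating the join, the probability factors by applying
the two hypotheses in turn. This combines the independence of the initial model from the whole
stream with the independence of the steps. -/
theorem indep_sup_left {m₁ m₂ m₃ : MeasurableSpace Ω} [IsProbabilityMeasure P]
    (h₁ : m₁ ≤ mΩ) (h₂ : m₂ ≤ mΩ) (h₃ : m₃ ≤ mΩ)
    (h123 : Indep m₁ (m₂ ⊔ m₃) P) (h23 : Indep m₂ m₃ P) : Indep (m₁ ⊔ m₂) m₃ P := by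
  set π : Set (Set Ω) := {u | ∃ s t, MeasurableSet[m₁] s ∧ MeasurableSet[m₂] t ∧ u = s ∩ t}
  have hπ : IsPiSystem π := by
    rintro _ ⟨s, t, hs, ht, rfl⟩ _ ⟨s', t', hs', ht', rfl⟩ _
    exact ⟨s ∩ s', t ∩ t', hs.inter hs', ht.inter ht', Set.inter_inter_inter_comm _ _ _ _⟩
  have hgen : m₁ ⊔ m₂ = MeasurableSpace.generateFrom π := by
    apply le_antisymm
    · refine sup_le (fun s hs => ?_) (fun t ht => ?_)
      · exact MeasurableSpace.measurableSet_generateFrom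
          ⟨s, Set.univ, hs, MeasurableSet.univ, (Set.inter_univ s).symm⟩
      · exact MeasurableSpace.measurableSet_generateFrom
          ⟨Set.univ, t, MeasurableSet.univ, ht, (Set.univ_inter t).symm⟩
    · refine MeasurableSpace.generateFrom_le ?_
      rintro _ ⟨s, t, hs, ht, rfl⟩
      exact MeasurableSet.inter ((le_sup_left : m₁ ≤ m₁ ⊔ m₂) s hs)
        ((le_sup_right : m₂ ≤ m₁ ⊔ m₂) t ht)
  refine IndepSets.indep (sup_le h₁ h₂) h₃ hπ (@MeasurableSpace.isPiSystem_measurableSet _ m₃) hgen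
    (MeasurableSpace.generateFrom_measurableSet).symm ?_
  rw [IndepSets_iff]
  rintro _ u ⟨s, t, hs, ht, rfl⟩ hu
  have hu' : MeasurableSet[m₃] u := hu
  rw [Indep_iff] at h123 h23
  have hle2 : m₂ ≤ m₂ ⊔ m₃ := le_sup_left
  have hle3 : m₃ ≤ m₂ ⊔ m₃ := le_sup_right
  rw [Set.inter_assoc, h123 s (t ∩ u) hs (MeasurableSet.inter (hle2 t ht) (hle3 u hu')),
    h23 t u ht hu', h123 s t hs (hle2 t ht), mul_assoc]

variable {α β : Type*} [MeasurableSpace α] [MeasurableSpace β]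

/-- What is known before step `k`. -/
@[reducible] def past (x₀ : Ω → α) (Z : ℕ → Ω → β) (k : ℕ) : MeasurableSpace Ω :=
  MeasurableSpace.comap x₀ inferInstance ⊔
    ⨆ l ∈ Set.Iio k, MeasurableSpace.comap (Z l) inferInstance

/-- What is sampled from step `k` on. -/
@[reducible] def future (Z : ℕ → Ω → β) (k : ℕ) : MeasurableSpace Ω :=
  ⨆ l ∈ Set.Ici k, MeasurableSpace.comap (Z l) inferInstance

theorem past_le {x₀ : Ω → α} {Z : ℕ → Ω → β} (hx : Measurable x₀) (hZ : ∀ l, Measurable (Z l))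
    (k : ℕ) : past x₀ Z k ≤ mΩ :=
  sup_le hx.comap_le (iSup₂_le fun l _ => (hZ l).comap_le)

theorem future_le {Z : ℕ → Ω → β} (hZ : ∀ l, Measurable (Z l)) (k : ℕ) : future Z k ≤ mΩ :=
  iSup₂_le fun l _ => (hZ l).comap_le

theorem measurable_past_init (x₀ : Ω → α) (Z : ℕ → Ω → β) (k : ℕ) :
    Measurable[past x₀ Z k] x₀ :=
  (comap_measurable x₀).mono le_sup_left le_rfl

theorem measurable_past (x₀ : Ω → α) (Z : ℕ → Ω → β) {k l : ℕ} (h : l < k) :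
    Measurable[past x₀ Z k] (Z l) :=
  (comap_measurable (Z l)).mono
    (le_sup_of_le_right (le_iSup₂_of_le l (Set.mem_Iio.2 h) le_rfl)) le_rfl

theorem measurable_future (Z : ℕ → Ω → β) {k l : ℕ} (h : k ≤ l) :
    Measurable[future Z k] (Z l) :=
  (comap_measurable (Z l)).mono (le_iSup₂_of_le l (Set.mem_Ici.2 h) le_rfl) le_rfl

theorem indep_past_future [IsProbabilityMeasure P] {x₀ : Ω → α} {Z : ℕ → Ω → β}
    (hx : Measurable x₀) (hZ : ∀ l, Measurable (Z l)) (hind : iIndepFun Z P)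
    (hinit : IndepFun x₀ (fun ω l => Z l ω) P) (k : ℕ) :
    Indep (past x₀ Z k) (future Z k) P := by
  refine indep_sup_left hx.comap_le (iSup₂_le fun l _ => (hZ l).comap_le) (future_le hZ k) ?_ ?_
  · refine indep_of_indep_of_le_right hinit ?_
    have h : ∀ l, MeasurableSpace.comap (Z l) inferInstance ≤
        MeasurableSpace.comap (fun ω l => Z l ω) MeasurableSpace.pi := by
      intro l
      have h1 : Measurable[MeasurableSpace.comap (fun ω l => Z l ω) MeasurableSpace.pi] (Z l) :=
        (measurable_pi_apply l).comp (comap_measurable (fun ω l => Z l ω))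
      exact h1.comap_le
    exact sup_le (iSup₂_le fun l _ => h l) (iSup₂_le fun l _ => h l)
  · refine indep_iSup_of_disjoint (fun l => (hZ l).comap_le) hind ?_
    rw [Set.disjoint_left]
    intro l hl hl'
    exact absurd (Set.mem_Iio.1 hl) (not_lt.2 (Set.mem_Ici.1 hl'))

theorem IndepFun.of_indep {m₁ m₂ : MeasurableSpace Ω} (h : Indep m₁ m₂ P) {X : Ω → α} {Y : Ω → β}
    (hX : Measurable[m₁] X) (hY : Measurable[m₂] Y) : IndepFun X Y P :=
  indep_of_indep_of_le h hX.comap_le hY.comap_le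

/-- Conditioning on `X` by Tonelli: the joint law is a product. No integrability is needed, so
second moments can be bounded before anything is known to be integrable. -/
theorem lintegral_comp_of_indepFun [IsProbabilityMeasure P] {X : Ω → α} {Y : Ω → β}
    (hX : Measurable X) (hY : Measurable Y) (h : IndepFun X Y P) {ψ : α → β → ENNReal}
    (hψ : Measurable (Function.uncurry ψ)) :
    ∫⁻ ω, ψ (X ω) (Y ω) ∂P = ∫⁻ ω, ∫⁻ ω', ψ (X ω) (Y ω') ∂P ∂P := by
  have hm := (indepFun_iff_map_prod_eq_prod_map_map hX.aemeasurable hY.aemeasurable).1 h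
  have : IsProbabilityMeasure (P.map Y) := Measure.isProbabilityMeasure_map hY.aemeasurable
  have h1 : ∫⁻ q, Function.uncurry ψ q ∂(P.map fun ω => (X ω, Y ω)) = ∫⁻ ω, ψ (X ω) (Y ω) ∂P :=
    lintegral_map hψ (hX.prodMk hY)
  rw [← h1, hm, lintegral_prod _ hψ.aemeasurable,
    lintegral_map (Measurable.lintegral_prod_right' hψ) hX]
  refine lintegral_congr fun ω => ?_
  exact lintegral_map (hψ.comp measurable_prodMk_left) hY

theorem integral_comp_of_indepFun [IsProbabilityMeasure P] {E : Type*} [NormedAddCommGroup E]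
    [NormedSpace ℝ E] {X : Ω → α} {Y : Ω → β}
    (hX : Measurable X) (hY : Measurable Y) (h : IndepFun X Y P) {ψ : α → β → E}
    (hψ : StronglyMeasurable (Function.uncurry ψ)) (hint : Integrable (fun ω => ψ (X ω) (Y ω)) P) :
    ∫ ω, ψ (X ω) (Y ω) ∂P = ∫ ω, ∫ ω', ψ (X ω) (Y ω') ∂P ∂P := by
  have hm := (indepFun_iff_map_prod_eq_prod_map_map hX.aemeasurable hY.aemeasurable).1 h
  have : IsProbabilityMeasure (P.map X) := Measure.isProbabilityMeasure_map hX.aemeasurable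
  have : IsProbabilityMeasure (P.map Y) := Measure.isProbabilityMeasure_map hY.aemeasurable
  have h1 : ∫ q, Function.uncurry ψ q ∂(P.map fun ω => (X ω, Y ω)) = ∫ ω, ψ (X ω) (Y ω) ∂P :=
    integral_map (hX.prodMk hY).aemeasurable hψ.aestronglyMeasurable
  have h2 : Integrable (Function.uncurry ψ) ((P.map X).prod (P.map Y)) := by
    rw [← hm, integrable_map_measure hψ.aestronglyMeasurable (hX.prodMk hY).aemeasurable]
    exact hint
  rw [← h1, hm, integral_prod _ h2, integral_map hX.aemeasurable
    (StronglyMeasurable.integral_prod_right' hψ).aestronglyMeasurable]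
  refine integral_congr_ae (Filter.Eventually.of_forall fun ω => ?_)
  exact integral_map hY.aemeasurable
    (hψ.comp_measurable measurable_prodMk_left).aestronglyMeasurable

theorem lintegral_comp_of_finite {ι : Type*} [Fintype ι] [MeasurableSpace ι]
    [MeasurableSingletonClass ι] {w : Ω → ι} (hw : Measurable w) (φ : ι → ENNReal) :
    ∫⁻ ω, φ (w ω) ∂P = ∑ i, φ i * P {ω | w ω = i} := by
  rw [← lintegral_map (measurable_of_finite φ) hw, lintegral_fintype]
  refine Finset.sum_congr rfl fun i _ => ?_
  rw [Measure.map_apply hw (measurableSet_singleton i)]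
  rfl

theorem integral_comp_of_finite [IsFiniteMeasure P] {ι E : Type*} [Fintype ι] [MeasurableSpace ι]
    [MeasurableSingletonClass ι] [NormedAddCommGroup E] [NormedSpace ℝ E] [CompleteSpace E]
    {w : Ω → ι} (hw : Measurable w) (φ : ι → E) :
    ∫ ω, φ (w ω) ∂P = ∑ i, P.real {ω | w ω = i} • φ i := by
  have : IsFiniteMeasure (P.map w) := Measure.isFiniteMeasure_map P w
  have h1 : AEStronglyMeasurable φ (P.map w) :=
    (StronglyMeasurable.of_discrete).aestronglyMeasurable
  rw [← integral_map hw.aemeasurable h1, integral_fintype .of_finite]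
  refine Finset.sum_congr rfl fun i _ => ?_
  rw [map_measureReal_apply hw (measurableSet_singleton i)]
  rfl

end Independence

/-! ### Square integrable random vectors -/

section SquareIntegrable

variable {Ω : Type*} {mΩ : MeasurableSpace Ω} {P : Measure Ω}
  {E : Type*} [NormedAddCommGroup E]

theorem _root_.MeasureTheory.MemLp.integrable_norm_sq {f : Ω → E} (hf : MemLp f 2 P) :
    Integrable (fun ω => ‖f ω‖ ^ 2) P :=
  (memLp_two_iff_integrable_sq_norm hf.1).1 hf

theorem memLp_two_of_lintegral_ne_top {f : Ω → E} (hf : AEStronglyMeasurable f P)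
    (h : ∫⁻ ω, ENNReal.ofReal (‖f ω‖ ^ 2) ∂P ≠ ⊤) : MemLp f 2 P :=
  (memLp_two_iff_integrable_sq_norm hf).2 <|
    (lintegral_ofReal_ne_top_iff_integrable (hf.norm.pow 2)
      (Filter.Eventually.of_forall fun _ => sq_nonneg _)).1 h

theorem ofReal_integral_norm_sq {f : Ω → E} (hf : MemLp f 2 P) :
    ENNReal.ofReal (∫ ω, ‖f ω‖ ^ 2 ∂P) = ∫⁻ ω, ENNReal.ofReal (‖f ω‖ ^ 2) ∂P :=
  ofReal_integral_eq_lintegral_ofReal hf.integrable_norm_sq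
    (Filter.Eventually.of_forall fun _ => sq_nonneg _)

variable [InnerProductSpace ℝ E]

theorem _root_.MeasureTheory.MemLp.integrable_inner_two {f g : Ω → E} (hf : MemLp f 2 P)
    (hg : MemLp g 2 P) :
    Integrable (fun ω => inner ℝ (f ω) (g ω)) P := by
  refine (hf.integrable_norm_sq.add hg.integrable_norm_sq).mono' (hf.1.inner hg.1)
    (Filter.Eventually.of_forall fun ω => ?_)
  have h1 := norm_inner_le_norm (𝕜 := ℝ) (f ω) (g ω)
  simp only [Pi.add_apply]
  nlinarith [sq_nonneg (‖f ω‖ - ‖g ω‖), sq_nonneg (‖f ω‖ + ‖g ω‖)]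

/-- Independence and zero mean kill the cross terms. This is why a minibatch contributes noise `M *
σ²` and not `M² * σ²`. -/
theorem integral_norm_sum_sq_of_indep [IsProbabilityMeasure P] [CompleteSpace E]
    [MeasurableSpace E] [BorelSpace E] {ι : Type*}
    [Fintype ι] {e : ι → Ω → E} (hL : ∀ m, MemLp (e m) 2 P) (h0 : ∀ m, ∫ ω, e m ω ∂P = 0)
    (hind : ∀ m m', m ≠ m' → IndepFun (e m) (e m') P) :
    ∫ ω, ‖∑ m, e m ω‖ ^ 2 ∂P = ∑ m, ∫ ω, ‖e m ω‖ ^ 2 ∂P := by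
  classical
  have h1 : ∀ ω, ‖∑ m, e m ω‖ ^ 2 = ∑ m, ∑ m', inner ℝ (e m ω) (e m' ω) := by
    intro ω
    rw [← real_inner_self_eq_norm_sq, sum_inner]
    exact Finset.sum_congr rfl fun m _ => inner_sum _ _ _
  simp_rw [h1]
  rw [integral_finsetSum _ fun m _ => integrable_finsetSum _ fun m' _ =>
    (hL m).integrable_inner_two (hL m')]
  refine Finset.sum_congr rfl fun m _ => ?_
  rw [integral_finsetSum _ fun m' _ => (hL m).integrable_inner_two (hL m'),
    Finset.sum_eq_single m]
  · simp_rw [real_inner_self_eq_norm_sq]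
  · intro m' _ hm'
    have := (hind m m' hm'.symm).integral_bilin ((hL m).integrable one_le_two)
      ((hL m').integrable one_le_two) (innerSL ℝ)
    rw [h0 m, map_zero] at this
    exact this
  · simp

end SquareIntegrable

/-! ### The stochastic gradients -/

section StochGrad

variable {n N : ℕ} {Ξ : Type*} [MeasurableSpace Ξ] {p : Fin n → ℝ}
  {F : Fin n → EuclideanSpace ℝ (Fin N) → Ξ → ℝ} {D : Fin n → Measure Ξ} {L : ℝ≥0} {σ ς : ℝ}

/-- The sample loss is continuous in the model and measurable in the sample, hence jointly
measurable; each coordinate of the gradient is a limit of difference quotients with increment `1 /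
m`. -/
theorem LossAssumptions.measurable_stochGrad (h : LossAssumptions p F D L σ ς) (i : Fin n) :
    Measurable (fun q : EuclideanSpace ℝ (Fin N) × Ξ => stochGrad F i q.1 q.2) := by
  have hF : Measurable (fun q : EuclideanSpace ℝ (Fin N) × Ξ => F i q.1 q.2) :=
    measurable_uncurry_of_continuous_of_measurable (u := F i)
      (fun ξ => (h.differentiable_loss i ξ).continuous) (h.measurable_loss i)
  have hcoord : ∀ j, Measurable fun q : EuclideanSpace ℝ (Fin N) × Ξ =>
      (stochGrad F i q.1 q.2) j := by
    intro j
    set e : EuclideanSpace ℝ (Fin N) := EuclideanSpace.single j 1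
    have hlim : ∀ q : EuclideanSpace ℝ (Fin N) × Ξ, Filter.Tendsto
        (fun m : ℕ => (m : ℝ) • (F i (q.1 + (m : ℝ)⁻¹ • e) q.2 - F i q.1 q.2)) Filter.atTop
        (nhds ((stochGrad F i q.1 q.2) j)) := by
      intro q
      have hd := h.differentiable_loss i q.2 q.1
      have hc : Filter.Tendsto (fun m : ℕ => ‖(m : ℝ)‖) Filter.atTop Filter.atTop := by
        simpa using tendsto_natCast_atTop_atTop (R := ℝ)
      have h1 := hd.hasFDerivAt.lim e hc
      have h2 : (stochGrad F i q.1 q.2) j = (fderiv ℝ (fun x => F i x q.2) q.1) e := by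
        rw [← inner_gradient_left, EuclideanSpace.inner_single_right]
        simp [stochGrad]
      rw [h2]
      exact h1
    refine measurable_of_tendsto_metrizable (fun m => ?_) (tendsto_pi_nhds.2 hlim)
    have h3 : Measurable fun q : EuclideanSpace ℝ (Fin N) × Ξ =>
        F i (q.1 + (m : ℝ)⁻¹ • e) q.2 :=
      hF.comp ((measurable_fst.add_const _).prodMk measurable_snd)
    exact (h3.sub hF).const_smul (m : ℝ)
  exact (MeasurableEquiv.toLp 2 (Fin N → ℝ)).measurable.comp (measurable_pi_lambda _ hcoord)

theorem LossAssumptions.measurable_stochGrad_left (h : LossAssumptions p F D L σ ς) (i : Fin n)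
    (x : EuclideanSpace ℝ (Fin N)) : Measurable (stochGrad F i x) :=
  (h.measurable_stochGrad i).comp measurable_prodMk_left

theorem LossAssumptions.memLp_stochGrad_sub (h : LossAssumptions p F D L σ ς) (i : Fin n)
    (x : EuclideanSpace ℝ (Fin N)) :
    MemLp (fun ξ => stochGrad F i x ξ - ∇ (localLoss F D i) x) 2 (D i) :=
  (memLp_two_iff_integrable_sq_norm
    ((h.measurable_stochGrad_left i x).sub_const _).aestronglyMeasurable).2
    (h.integrable_variance i x)

theorem LossAssumptions.integral_stochGrad_sub (h : LossAssumptions p F D L σ ς) (i : Fin n)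
    (x : EuclideanSpace ℝ (Fin N)) :
    ∫ ξ, (stochGrad F i x ξ - ∇ (localLoss F D i) x) ∂(D i) = 0 := by
  have := h.isProbabilityMeasure i
  have h1 : Integrable (stochGrad F i x) (D i) := by
    have := ((h.memLp_stochGrad_sub i x).integrable one_le_two).add
      (integrable_const (∇ (localLoss F D i) x))
    refine this.congr (Filter.Eventually.of_forall fun ξ => ?_)
    simp
  rw [integral_sub h1 (integrable_const _), h.unbiased]
  simp

/-- The sum of the stochastic gradients of worker `i`, evaluated at `y i`, over the minibatch
`z i`. -/
def batchGrad {M : ℕ} (F : Fin n → EuclideanSpace ℝ (Fin N) → Ξ → ℝ)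
    (y : Fin n → EuclideanSpace ℝ (Fin N)) (i : Fin n) (z : Fin n → Fin M → Ξ) :
    EuclideanSpace ℝ (Fin N) :=
  ∑ m, stochGrad F i (y i) (z i m)

theorem LossAssumptions.measurable_batchGrad {M : ℕ} (h : LossAssumptions p F D L σ ς) :
    Measurable (fun q : (Fin n → EuclideanSpace ℝ (Fin N)) × Fin n × (Fin n → Fin M → Ξ) =>
      batchGrad F q.1 q.2.1 q.2.2) := by
  have h1 : Measurable (fun q : ((Fin n → EuclideanSpace ℝ (Fin N)) × (Fin n → Fin M → Ξ)) ×
      Fin n => batchGrad F q.1.1 q.2 q.1.2) := by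
    refine measurable_from_prod_countable_left fun i => ?_
    have h2 : ∀ m, Measurable fun q : (Fin n → EuclideanSpace ℝ (Fin N)) × (Fin n → Fin M → Ξ) =>
        stochGrad F i (q.1 i) (q.2 i m) := fun m => by
      have h3 : Measurable fun q : (Fin n → EuclideanSpace ℝ (Fin N)) ×
          (Fin n → Fin M → Ξ) => (q.1 i, q.2 i m) :=
        ((measurable_pi_apply i).comp measurable_fst).prodMk
          ((measurable_pi_apply m).comp ((measurable_pi_apply i).comp measurable_snd))
      exact (h.measurable_stochGrad i).comp h3
    exact Finset.measurable_fun_sum _ fun m _ => h2 m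
  have h4 : Measurable fun q : (Fin n → EuclideanSpace ℝ (Fin N)) × Fin n ×
      (Fin n → Fin M → Ξ) => ((q.1, q.2.2), q.2.1) :=
    (measurable_fst.prodMk measurable_snd.snd).prodMk measurable_snd.fst
  have h5 := h1.comp h4
  exact h5

variable {Ω : Type*} {mΩ : MeasurableSpace Ω} {P : Measure Ω} [IsProbabilityMeasure P] {M : ℕ}

/-- Second moment and mean of a minibatch gradient of worker `i` at a fixed point. -/
theorem LossAssumptions.batchGrad_moments (h : LossAssumptions p F D L σ ς)
    {ξ : Ω → Fin n → Fin M → Ξ} (hξ : Measurable ξ)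
    (hlaw : ∀ i m, P.map (fun ω => ξ ω i m) = D i)
    (hind : iIndepFun (fun (q : Fin n × Fin M) ω => ξ ω q.1 q.2) P)
    (y : Fin n → EuclideanSpace ℝ (Fin N)) (i : Fin n) :
    MemLp (fun ω => batchGrad F y i (ξ ω)) 2 P ∧
    ∫ ω, batchGrad F y i (ξ ω) ∂P = (M : ℝ) • ∇ (localLoss F D i) (y i) ∧
    ∫ ω, ‖batchGrad F y i (ξ ω)‖ ^ 2 ∂P ≤
      M * σ ^ 2 + M ^ 2 * ‖∇ (localLoss F D i) (y i)‖ ^ 2 := by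
  set g := ∇ (localLoss F D i) (y i)
  have hξm : ∀ m, Measurable fun ω => ξ ω i m := fun m =>
    (measurable_pi_apply m).comp ((measurable_pi_apply i).comp hξ)
  have hφ : Measurable fun z => stochGrad F i (y i) z - g :=
    (h.measurable_stochGrad_left i (y i)).sub_const _
  set e : Fin M → Ω → EuclideanSpace ℝ (Fin N) := fun m ω => stochGrad F i (y i) (ξ ω i m) - g
  have heL : ∀ m, MemLp (e m) 2 P := fun m =>
    (memLp_map_measure_iff hφ.aestronglyMeasurable (hξm m).aemeasurable).1
      (by rw [hlaw]; exact h.memLp_stochGrad_sub i (y i))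
  have he0 : ∀ m, ∫ ω, e m ω ∂P = 0 := fun m => by
    rw [← h.integral_stochGrad_sub i (y i), ← hlaw i m,
      integral_map (hξm m).aemeasurable hφ.aestronglyMeasurable]
  have hev : ∀ m, ∫ ω, ‖e m ω‖ ^ 2 ∂P ≤ σ ^ 2 := fun m => by
    refine le_trans (le_of_eq ?_) (h.variance_le i (y i))
    rw [← hlaw i m,
      integral_map (hξm m).aemeasurable (hφ.norm.pow_const 2).aestronglyMeasurable]
  have heind : ∀ m m', m ≠ m' → IndepFun (e m) (e m') P := fun m m' hm =>
    (hind.indepFun (i := (i, m)) (j := (i, m')) (by simpa using hm)).comp hφ hφ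
  have hsL : MemLp (fun ω => ∑ m, e m ω) 2 P := memLp_finsetSum _ fun m _ => heL m
  have hs0 : ∫ ω, ∑ m, e m ω ∂P = 0 := by
    rw [integral_finsetSum _ fun m _ => (heL m).integrable one_le_two]
    simp [he0]
  -- Centred noise plus its mean: the two parts are orthogonal in expectation.
  have hdec : ∀ ω, batchGrad F y i (ξ ω) = ∑ m, e m ω + (M : ℝ) • g := fun ω => by
    simp [batchGrad, e, g, Finset.sum_sub_distrib, ← Nat.cast_smul_eq_nsmul ℝ]
  simp_rw [hdec]
  refine ⟨hsL.add (memLp_const _), ?_, ?_⟩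
  · rw [integral_add (hsL.integrable one_le_two) (integrable_const _), hs0]
    simp
  · have h1 : ∀ ω, ‖∑ m, e m ω + (M : ℝ) • g‖ ^ 2 =
        ‖∑ m, e m ω‖ ^ 2 + 2 * inner ℝ ((M : ℝ) • g) (∑ m, e m ω) + M ^ 2 * ‖g‖ ^ 2 := fun ω => by
      rw [norm_add_sq_real, real_inner_comm, norm_smul, mul_pow]
      simp
    have hi : Integrable (fun ω => inner ℝ ((M : ℝ) • g) (∑ m, e m ω)) P :=
      (hsL.integrable one_le_two).const_inner _
    simp_rw [h1]
    rw [integral_add (f := fun ω => ‖∑ m, e m ω‖ ^ 2 + 2 * inner ℝ ((M : ℝ) • g) (∑ m, e m ω))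
      (hsL.integrable_norm_sq.add (hi.const_mul 2)) (integrable_const _),
      integral_add hsL.integrable_norm_sq (hi.const_mul 2), integral_const_mul,
      integral_inner (hsL.integrable one_le_two), hs0,
      integral_norm_sum_sq_of_indep heL he0 heind]
    have h2 := Finset.sum_le_sum fun m (_ : m ∈ Finset.univ) => hev m
    simp only [Finset.sum_const, Finset.card_univ, Fintype.card_fin, nsmul_eq_mul] at h2
    simpa using h2

/-- Second moment and mean of the gradient of a random worker at fixed points. -/
theorem LossAssumptions.batchGrad_worker_moments (h : LossAssumptions p F D L σ ς)
    {w : Ω → Fin n} (hw : Measurable w) (hwlaw : ∀ i, P.real {ω | w ω = i} = p i)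
    {ξ : Ω → Fin n → Fin M → Ξ} (hξ : Measurable ξ)
    (hlaw : ∀ i m, P.map (fun ω => ξ ω i m) = D i)
    (hind : iIndepFun (fun (q : Fin n × Fin M) ω => ξ ω q.1 q.2) P)
    (hwξ : IndepFun w ξ P) (y : Fin n → EuclideanSpace ℝ (Fin N)) :
    MemLp (fun ω => batchGrad F y (w ω) (ξ ω)) 2 P ∧
    ∫ ω, batchGrad F y (w ω) (ξ ω) ∂P = (M : ℝ) • ∑ i, p i • ∇ (localLoss F D i) (y i) ∧
    ∫⁻ ω, ENNReal.ofReal (‖batchGrad F y (w ω) (ξ ω)‖ ^ 2) ∂P ≤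
      ENNReal.ofReal (M * σ ^ 2 + M ^ 2 * ∑ i, p i * ‖∇ (localLoss F D i) (y i)‖ ^ 2) := by
  have hmom := h.batchGrad_moments hξ hlaw hind y
  have hm : Measurable (fun q : Fin n × (Fin n → Fin M → Ξ) => batchGrad F y q.1 q.2) := by
    have h1 := h.measurable_batchGrad.comp (measurable_const.prodMk measurable_id :
      Measurable fun q : Fin n × (Fin n → Fin M → Ξ) => (y, q))
    exact h1
  have hmω : Measurable fun ω => batchGrad F y (w ω) (ξ ω) := by
    have h1 := hm.comp (hw.prodMk hξ : Measurable fun ω => (w ω, ξ ω))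
    exact h1
  have hle : ∫⁻ ω, ENNReal.ofReal (‖batchGrad F y (w ω) (ξ ω)‖ ^ 2) ∂P ≤
      ENNReal.ofReal (M * σ ^ 2 + M ^ 2 * ∑ i, p i * ‖∇ (localLoss F D i) (y i)‖ ^ 2) := by
    have hm2 : Measurable fun q : Fin n × (Fin n → Fin M → Ξ) =>
        ENNReal.ofReal (‖batchGrad F y q.1 q.2‖ ^ 2) := (hm.norm.pow_const 2).ennreal_ofReal
    rw [lintegral_comp_of_indepFun hw hξ hwξ
      (ψ := fun i z => ENNReal.ofReal (‖batchGrad F y i z‖ ^ 2)) hm2,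
      lintegral_comp_of_finite hw fun i =>
        ∫⁻ ω', ENNReal.ofReal (‖batchGrad F y i (ξ ω')‖ ^ 2) ∂P]

    have h1 : ∀ i, (∫⁻ ω', ENNReal.ofReal (‖batchGrad F y i (ξ ω')‖ ^ 2) ∂P) * P {ω | w ω = i} ≤
        ENNReal.ofReal ((M * σ ^ 2 + M ^ 2 * ‖∇ (localLoss F D i) (y i)‖ ^ 2) * p i) := by
      intro i
      rw [← ofReal_integral_norm_sq (hmom i).1, ← hwlaw i, ENNReal.ofReal_mul (by positivity),
        ofReal_measureReal]
      gcongr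
      exact (hmom i).2.2
    refine (Finset.sum_le_sum fun i _ => h1 i).trans (le_of_eq ?_)
    rw [← ENNReal.ofReal_sum_of_nonneg fun i _ => mul_nonneg (by positivity) (h.weight_nonneg i)]
    congr 1
    simp_rw [add_mul]
    rw [Finset.sum_add_distrib, ← Finset.mul_sum, h.weight_sum, mul_one, Finset.mul_sum]
    congr 1
    exact Finset.sum_congr rfl fun i _ => by ring
  -- The second moment bound comes first, because the formula for the mean needs integrability.
  have hL : MemLp (fun ω => batchGrad F y (w ω) (ξ ω)) 2 P :=
    memLp_two_of_lintegral_ne_top hmω.aestronglyMeasurable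
      (ne_top_of_le_ne_top ENNReal.ofReal_ne_top hle)
  refine ⟨hL, ?_, hle⟩
  rw [integral_comp_of_indepFun hw hξ hwξ (ψ := fun i z => batchGrad F y i z)
      hm.stronglyMeasurable (hL.integrable one_le_two),
    integral_comp_of_finite hw fun i => ∫ ω', batchGrad F y i (ξ ω') ∂P, Finset.smul_sum]
  refine Finset.sum_congr rfl fun i _ => ?_
  rw [(hmom i).2.1, hwlaw, smul_comm]

end StochGrad

/-! ### Contraction of products of random doubly stochastic matrices -/

section Mixing

open Matrix

variable {n : ℕ}

theorem abs_mulVec_le_of_mem_doublyStochastic {A : Matrix (Fin n) (Fin n) ℝ}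
    (hA : A ∈ doublyStochastic ℝ (Fin n)) {v : Fin n → ℝ} {c : ℝ} (hv : ∀ i, |v i| ≤ c)
    (i : Fin n) : |(A *ᵥ v) i| ≤ c := by
  calc |(A *ᵥ v) i| ≤ ∑ j, |A i j * v j| := by
        simp only [mulVec, dotProduct]
        exact Finset.abs_sum_le_sum_abs _ _
    _ ≤ ∑ j, A i j * c := by
        refine Finset.sum_le_sum fun j _ => ?_
        rw [abs_mul, abs_of_nonneg (nonneg_of_mem_doublyStochastic hA)]
        exact mul_le_mul_of_nonneg_left (hv j) (nonneg_of_mem_doublyStochastic hA)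
    _ = c := by rw [← Finset.sum_mul, sum_row_of_mem_doublyStochastic hA, one_mul]

/-- The product `W_a W_{a+1} ⋯ W_{a+m-1} u`. -/
def mixVec (W : ℕ → Matrix (Fin n) (Fin n) ℝ) (u : Fin n → ℝ) : ℕ → ℕ → Fin n → ℝ
  | _, 0 => u
  | a, m + 1 => W a *ᵥ mixVec W u (a + 1) m

/-- The contraction argument peels off the first matrix, as in the definition, while unrolling the
iteration peels off the last one. -/
theorem mixVec_succ_right (W : ℕ → Matrix (Fin n) (Fin n) ℝ) (u : Fin n → ℝ) (a m : ℕ) :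
    mixVec W u a (m + 1) = mixVec W (W (a + m) *ᵥ u) a m := by
  induction m generalizing a with
  | zero => simp [mixVec]
  | succ m ih =>
    rw [mixVec, ih (a + 1), mixVec]
    congr 4
    omega

theorem abs_mixVec_le {W : ℕ → Matrix (Fin n) (Fin n) ℝ}
    (hW : ∀ l, W l ∈ doublyStochastic ℝ (Fin n)) {u : Fin n → ℝ} {c : ℝ} (hu : ∀ i, |u i| ≤ c)
    (a m : ℕ) (i : Fin n) : |mixVec W u a m i| ≤ c := by
  induction m generalizing a i with
  | zero => exact hu i
  | succ m ih => exact abs_mulVec_le_of_mem_doublyStochastic (hW a) (ih (a + 1)) i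

theorem sum_mixVec {W : ℕ → Matrix (Fin n) (Fin n) ℝ}
    (hW : ∀ l, W l ∈ doublyStochastic ℝ (Fin n)) (u : Fin n → ℝ) (a m : ℕ) :
    ∑ i, mixVec W u a m i = ∑ i, u i := by
  induction m generalizing a with
  | zero => rfl
  | succ m ih => rw [mixVec, sum_mulVec_of_mem_doublyStochastic (hW a), ih]

theorem measurable_mixVec {Ω : Type*} {m₀ : MeasurableSpace Ω}
    {W : ℕ → Ω → Matrix (Fin n) (Fin n) ℝ} {a : ℕ}
    (hW : ∀ l, a ≤ l → ∀ i j, Measurable fun ω => W l ω i j) (u : Fin n → ℝ) (m : ℕ) :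
    Measurable fun ω => mixVec (fun l => W l ω) u a m := by
  induction m generalizing a with
  | zero => exact measurable_const
  | succ m ih =>
    have h1 := ih (a := a + 1) fun l hl => hW l (by omega)
    refine measurable_pi_lambda _ fun i => ?_
    simp only [mixVec, mulVec, dotProduct]
    exact Finset.measurable_fun_sum _ fun j _ =>
      (hW a le_rfl i j).mul ((measurable_pi_apply j).comp h1)

variable {Ω : Type*} {mΩ : MeasurableSpace Ω} {P : Measure Ω} [IsProbabilityMeasure P]

theorem sum_sq_mulVec_eq (A : Matrix (Fin n) (Fin n) ℝ) (v : Fin n → ℝ) :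
    ∑ i, (A *ᵥ v) i ^ 2 = ∑ a, ∑ b, (Aᵀ * A) a b * (v a * v b) := by
  have h1 : ∑ i, (A *ᵥ v) i ^ 2 = v ⬝ᵥ ((Aᵀ * A) *ᵥ v) := by
    rw [← mulVec_mulVec, dotProduct_mulVec, vecMul_transpose]
    simp [dotProduct, sq]
  rw [h1]
  simp only [dotProduct, mulVec, Finset.mul_sum]
  exact Finset.sum_congr rfl fun a _ => Finset.sum_congr rfl fun b _ => by ring

theorem expGram_mulVec_one {W : Ω → Matrix (Fin n) (Fin n) ℝ}
    (hm : ∀ i j, Measurable fun ω => W ω i j)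
    (hW : ∀ᵐ ω ∂P, W ω ∈ doublyStochastic ℝ (Fin n)) : expGram P W *ᵥ 1 = 1 := by
  have hGm : ∀ a b, Measurable fun ω => ((W ω)ᵀ * W ω) a b := fun a b => by
    simp only [mul_apply, transpose_apply]
    exact Finset.measurable_fun_sum _ fun c _ => (hm c a).mul (hm c b)
  have hG : ∀ᵐ ω ∂P, (W ω)ᵀ * W ω ∈ doublyStochastic ℝ (Fin n) := hW.mono fun ω hω =>
    mul_mem (transpose_mem_doublyStochastic_iff.2 hω) hω
  have hGi : ∀ a b, Integrable (fun ω => ((W ω)ᵀ * W ω) a b) P := fun a b =>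
    Integrable.of_bound (hGm a b).aestronglyMeasurable 1 (hG.mono fun ω hω => by
      rw [Real.norm_of_nonneg (nonneg_of_mem_doublyStochastic hω)]
      exact le_one_of_mem_doublyStochastic hω)
  ext a
  simp only [mulVec, dotProduct, expGram, of_apply, Pi.one_apply, mul_one]
  rw [← integral_finsetSum _ fun b _ => hGi a b]
  rw [integral_congr_ae (g := fun _ => (1 : ℝ))
    (hG.mono fun ω hω => sum_row_of_mem_doublyStochastic hω a)]
  simp

/-- By independence, `Wᵀ W` may be replaced by its expectation inside the quadratic form; the
deterministic spectral bound then applies pointwise to `v ω`. For `n < 2` a vector of sum zero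
vanishes. The bound `c` serves integrability only. -/
theorem integral_sum_sq_mulVec_le {W : Ω → Matrix (Fin n) (Fin n) ℝ}
    (hm : ∀ i j, Measurable fun ω => W ω i j)
    (hW : ∀ᵐ ω ∂P, W ω ∈ doublyStochastic ℝ (Fin n)) {ρ : ℝ} (hρ₀ : 0 ≤ ρ) (hρ₁ : ρ < 1)
    (hgap : SpectralGap P W ρ) {v : Ω → Fin n → ℝ} (hv : Measurable v) {c : ℝ}
    (hvc : ∀ᵐ ω ∂P, ∀ i, |v ω i| ≤ c) (hv0 : ∀ᵐ ω ∂P, ∑ i, v ω i = 0)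
    (hind : IndepFun (fun ω i j => W ω i j) v P) :
    ∫ ω, ∑ i, (W ω *ᵥ v ω) i ^ 2 ∂P ≤ ρ * ∫ ω, ∑ i, v ω i ^ 2 ∂P := by
  rcases lt_or_ge n 2 with hn | hn
  · have h0 : ∀ᵐ ω ∂P, v ω = 0 := hv0.mono fun ω hω => by
      ext i
      have : Subsingleton (Fin n) := Fin.subsingleton_iff_le_one.2 (by omega)
      rw [Fintype.sum_subsingleton _ i] at hω
      exact hω
    rw [integral_congr_ae (g := fun _ => (0 : ℝ)) (h0.mono fun ω hω => by simp [hω])]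
    simp only [integral_zero]
    exact mul_nonneg hρ₀ (integral_nonneg fun ω => Finset.sum_nonneg fun i _ => sq_nonneg _)
  · have hGm : ∀ a b, Measurable fun ω => ((W ω)ᵀ * W ω) a b := fun a b => by
      simp only [mul_apply, transpose_apply]
      exact Finset.measurable_fun_sum _ fun c _ => (hm c a).mul (hm c b)
    have hG : ∀ᵐ ω ∂P, (W ω)ᵀ * W ω ∈ doublyStochastic ℝ (Fin n) := hW.mono fun ω hω =>
      mul_mem (transpose_mem_doublyStochastic_iff.2 hω) hω
    have hvm : ∀ a, Measurable fun ω => v ω a := fun a => (measurable_pi_apply a).comp hv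
    have hvvm : ∀ a b, Measurable fun ω => v ω a * v ω b := fun a b => (hvm a).mul (hvm b)
    have hvv : ∀ a b, ∀ᵐ ω ∂P, ‖v ω a * v ω b‖ ≤ c * c := fun a b => hvc.mono fun ω hω => by
      rw [norm_mul]
      exact mul_le_mul (hω a) (hω b) (abs_nonneg _) ((abs_nonneg _).trans (hω a))
    have hvvi : ∀ a b, Integrable (fun ω => v ω a * v ω b) P := fun a b =>
      Integrable.of_bound (hvvm a b).aestronglyMeasurable (c * c) (hvv a b)
    have hGvi : ∀ a b, Integrable (fun ω => ((W ω)ᵀ * W ω) a b * (v ω a * v ω b)) P :=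
      fun a b => by
        refine Integrable.of_bound ((hGm a b).mul (hvvm a b)).aestronglyMeasurable (c * c) ?_
        filter_upwards [hG, hvv a b] with ω h1 h2
        rw [norm_mul, Real.norm_of_nonneg (nonneg_of_mem_doublyStochastic h1)]
        exact (mul_le_of_le_one_left (norm_nonneg _) (le_one_of_mem_doublyStochastic h1)).trans h2
    have hprod : ∀ a b, ∫ ω, ((W ω)ᵀ * W ω) a b * (v ω a * v ω b) ∂P =
        expGram P W a b * ∫ ω, v ω a * v ω b ∂P := fun a b => by
      have hφ : Measurable fun A : Fin n → Fin n → ℝ => ∑ c, A c a * A c b := by fun_prop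
      have hψ : Measurable fun x : Fin n → ℝ => x a * x b := by fun_prop
      exact (hind.comp hφ hψ).integral_fun_mul_eq_mul_integral
        (by
          have h1 := (hGm a b).aestronglyMeasurable (μ := P)
          exact h1)
        (by
          have h1 := (hvvm a b).aestronglyMeasurable (μ := P)
          exact h1)
    simp_rw [sum_sq_mulVec_eq]
    rw [integral_finsetSum _ fun a _ => integrable_finsetSum _ fun b _ => hGvi a b]
    simp_rw [integral_finsetSum _ fun b _ => hGvi _ b, hprod, ← integral_const_mul]
    simp_rw [← integral_finsetSum _ fun b _ => (hvvi _ b).const_mul (expGram P W _ b)]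
    rw [← integral_finsetSum _ fun a _ => integrable_finsetSum _ fun b _ =>
      (hvvi a b).const_mul (expGram P W a b)]
    refine integral_mono_ae (integrable_finsetSum _ fun a _ => integrable_finsetSum _ fun b _ =>
      (hvvi a b).const_mul (expGram P W a b)) ?_ ?_
    · refine Integrable.const_mul (integrable_finsetSum _ fun a _ => ?_) ρ
      simpa [sq] using hvvi a a
    · filter_upwards [hv0] with ω hω
      refine le_trans (le_of_eq ?_) (sum_mul_mul_le_of_sortedEigenvalue_le
        (expGram_isHermitian P W) hn hρ₁
        ((le_abs_self _).trans ((le_max_left _ _).trans (hgap hn))) (expGram_mulVec_one hm hW) hω)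
      exact Finset.sum_congr rfl fun a _ => Finset.sum_congr rfl fun b _ => by ring

/-- In mean square, a product of independent averaging matrices contracts the vectors of sum
zero. -/
theorem integral_sum_sq_mixVec_le {W : ℕ → Ω → Matrix (Fin n) (Fin n) ℝ}
    (hm : ∀ l i j, Measurable fun ω => W l ω i j)
    (hW : ∀ l, ∀ᵐ ω ∂P, W l ω ∈ doublyStochastic ℝ (Fin n)) {ρ : ℝ} (hρ₀ : 0 ≤ ρ) (hρ₁ : ρ < 1)
    (hgap : ∀ l, SpectralGap P (W l) ρ) {u : Fin n → ℝ} (hu : ∑ i, u i = 0)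
    (hind : ∀ a m, IndepFun (fun ω i j => W a ω i j)
      (fun ω => mixVec (fun l => W l ω) u (a + 1) m) P) (a m : ℕ) :
    ∫ ω, ∑ i, mixVec (fun l => W l ω) u a m i ^ 2 ∂P ≤ ρ ^ m * ∑ i, u i ^ 2 := by
  have hall : ∀ᵐ ω ∂P, ∀ l, W l ω ∈ doublyStochastic ℝ (Fin n) := ae_all_iff.2 hW
  have huc : ∀ i, |u i| ≤ ∑ i, |u i| := fun i =>
    Finset.single_le_sum (f := fun i => |u i|) (fun j _ => abs_nonneg (u j)) (Finset.mem_univ i)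
  induction m generalizing a with
  | zero => simp [mixVec]
  | succ m ih =>
    simp only [mixVec]
    refine (integral_sum_sq_mulVec_le (hm a) (hW a) hρ₀ hρ₁ (hgap a)
      (measurable_mixVec (fun l _ => hm l) u m)
      (hall.mono fun ω hω => abs_mixVec_le hω huc (a + 1) m)
      (hall.mono fun ω hω => (sum_mixVec hω u (a + 1) m).trans hu) (hind a m)).trans ?_
    rw [pow_succ', mul_assoc]
    exact mul_le_mul_of_nonneg_left (ih (a + 1)) hρ₀

end Mixing

/-! ### The AD-PSGD process -/

section Trajectory

variable {n N M : ℕ} {Ξ Ω : Type*} [MeasurableSpace Ξ] {mΩ : MeasurableSpace Ω}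

/-- Everything that is sampled at step `k`. -/
def stepVars (w : ℕ → Ω → Fin n) (W : ℕ → Ω → Matrix (Fin n) (Fin n) ℝ)
    (ξ : ℕ → Ω → Fin n → Fin M → Ξ) (k : ℕ) (ω : Ω) :
    Fin n × (Fin n → Fin n → ℝ) × (Fin n → Fin M → Ξ) :=
  (w k ω, fun i j => W k ω i j, ξ k ω)

/-- The nonzero column of `∂g(X_{k-τ_k}; ξ_k, i_k)`. -/
def gradStep (F : Fin n → EuclideanSpace ℝ (Fin N) → Ξ → ℝ) (τ : ℕ → ℕ)
    (w : ℕ → Ω → Fin n) (ξ : ℕ → Ω → Fin n → Fin M → Ξ)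
    (X : ℕ → Ω → Fin n → EuclideanSpace ℝ (Fin N)) (k : ℕ) (ω : Ω) : EuclideanSpace ℝ (Fin N) :=
  batchGrad F (X (k - τ k) ω) (w k ω) (ξ k ω)

/-- The process `X` is a run of AD-PSGD under the standing assumptions. -/
structure Run (P : Measure Ω)
    (p : Fin n → ℝ) (F : Fin n → EuclideanSpace ℝ (Fin N) → Ξ → ℝ) (D : Fin n → Measure Ξ)
    (L : ℝ≥0) (σ ς ρ γ : ℝ) (τ : ℕ → ℕ)
    (x₀ : Ω → EuclideanSpace ℝ (Fin N)) (w : ℕ → Ω → Fin n)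
    (W : ℕ → Ω → Matrix (Fin n) (Fin n) ℝ) (ξ : ℕ → Ω → Fin n → Fin M → Ξ)
    (X : ℕ → Ω → Fin n → EuclideanSpace ℝ (Fin N)) : Prop where
  rho_nonneg : 0 ≤ ρ
  rho_lt_one : ρ < 1
  loss : LossAssumptions p F D L σ ς
  sampling : SamplingAssumptions P p D ρ x₀ w W ξ
  integrable_init : Integrable (fun ω => globalLoss p F D (x₀ ω)) P
  delay_le : ∀ k, τ k ≤ k
  eq_iterate : ∀ k ω, X k ω =
    iterate F γ τ (x₀ ω) (fun l => w l ω) (fun l => W l ω) (fun l => ξ l ω) k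

variable {P : Measure Ω}
  {p : Fin n → ℝ} {F : Fin n → EuclideanSpace ℝ (Fin N) → Ξ → ℝ} {D : Fin n → Measure Ξ}
  {L : ℝ≥0} {σ ς ρ γ : ℝ} {τ : ℕ → ℕ}
  {x₀ : Ω → EuclideanSpace ℝ (Fin N)} {w : ℕ → Ω → Fin n}
  {W : ℕ → Ω → Matrix (Fin n) (Fin n) ℝ} {ξ : ℕ → Ω → Fin n → Fin M → Ξ}
  {X : ℕ → Ω → Fin n → EuclideanSpace ℝ (Fin N)}

theorem measurable_meanModel {m : MeasurableSpace Ω} {Y : Ω → Fin n → EuclideanSpace ℝ (Fin N)}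
    (hY : Measurable Y) : Measurable fun ω => meanModel (Y ω) := by
  have h1 : ∀ i, Measurable fun ω => Y ω i := fun i => (measurable_pi_apply i).comp hY
  exact (Finset.measurable_fun_sum _ fun i _ => h1 i).fun_const_smul (n : ℝ)⁻¹

namespace Run

theorem nonempty_workers (h : Run P p F D L σ ς ρ γ τ x₀ w W ξ X) : 0 < n := by
  rcases Nat.eq_zero_or_pos n with rfl | hn
  · have := h.loss.weight_sum
    simp at this
  · exact hn

theorem X_zero (h : Run P p F D L σ ς ρ γ τ x₀ w W ξ X) (ω : Ω) (i : Fin n) :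
    X 0 ω i = x₀ ω := by
  rw [h.eq_iterate, iterate]

theorem X_succ (h : Run P p F D L σ ς ρ γ τ x₀ w W ξ X) (k : ℕ) (ω : Ω) (i : Fin n) :
    X (k + 1) ω i = (∑ j, W k ω j i • X k ω j) -
      γ • if i = w k ω then gradStep F τ w ξ X k ω else 0 := by
  rw [h.eq_iterate, iterate]
  beta_reduce
  congr 1
  · exact Finset.sum_congr rfl fun j _ => by rw [h.eq_iterate]
  · congr 1
    split_ifs with hi
    · rw [gradStep, batchGrad, h.eq_iterate, hi]
    · rfl

theorem measurable_stepVars (h : Run P p F D L σ ς ρ γ τ x₀ w W ξ X) (k : ℕ) :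
    Measurable (stepVars w W ξ k) :=
  (h.sampling.measurable_worker k).prodMk
    ((measurable_pi_lambda _ fun i => measurable_pi_lambda _ fun j =>
      h.sampling.measurable_matrix k i j).prodMk (h.sampling.measurable_sample k))

/-- The σ-algebra is left free, here and in `measurable_X_of`, so that it can be taken to be the
past, as independence requires. -/
theorem measurable_gradStep_of (h : Run P p F D L σ ς ρ γ τ x₀ w W ξ X)
    {m : MeasurableSpace Ω} {k : ℕ} (hX : Measurable[m] (X (k - τ k)))
    (hZ : Measurable[m] (stepVars w W ξ k)) : Measurable[m] (gradStep F τ w ξ X k) := by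
  have h1 : Measurable[m] fun ω => (X (k - τ k) ω, w k ω, ξ k ω) :=
    hX.prodMk (hZ.fst.prodMk hZ.snd.snd)
  have h2 := h.loss.measurable_batchGrad.comp h1
  exact h2

theorem measurable_X_of (h : Run P p F D L σ ς ρ γ τ x₀ w W ξ X)
    {m : MeasurableSpace Ω} {l : ℕ} (hx : Measurable[m] x₀)
    (hZ : ∀ k < l, Measurable[m] (stepVars w W ξ k)) {k : ℕ} (hk : k ≤ l) :
    Measurable[m] (X k) := by
  induction k using Nat.strong_induction_on with
  | _ k ih =>
    rcases k with _ | k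
    · have h1 : X 0 = fun ω _ => x₀ ω := by
        ext1 ω
        ext1 i
        exact h.X_zero ω i
      rw [h1]
      exact measurable_pi_lambda _ fun _ => hx
    · have hG := h.measurable_gradStep_of (ih (k - τ k) (by omega) (by omega)) (hZ k (by omega))
      have hXk := ih k (by omega) (by omega)
      refine measurable_pi_lambda _ fun i => ?_
      simp_rw [h.X_succ]
      refine Measurable.sub ?_ (Measurable.const_smul ?_ γ)
      · refine Finset.measurable_fun_sum _ fun j _ => Measurable.fun_smul ?_ ?_
        · have h2 := (measurable_pi_apply i).comp
            ((measurable_pi_apply j).comp (hZ k (by omega)).snd.fst)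
          exact h2
        · exact (measurable_pi_apply j).comp hXk
      · refine Measurable.ite ?_ hG measurable_const
        have h3 : Measurable[m] (w k) := (hZ k (by omega)).fst
        have h4 := h3 (measurableSet_singleton i)
        convert h4 using 1
        ext ω
        simp [eq_comm]

theorem measurable_past_X (h : Run P p F D L σ ς ρ γ τ x₀ w W ξ X) {k l : ℕ} (hk : k ≤ l) :
    Measurable[past x₀ (stepVars w W ξ) l] (X k) :=
  h.measurable_X_of (measurable_past_init _ _ _) (fun _ hk => measurable_past _ _ hk) hk

theorem past_le (h : Run P p F D L σ ς ρ γ τ x₀ w W ξ X) (l : ℕ) :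
    past x₀ (stepVars w W ξ) l ≤ mΩ :=
  ADPSGD.past_le h.sampling.measurable_init h.measurable_stepVars l

theorem measurable_X (h : Run P p F D L σ ς ρ γ τ x₀ w W ξ X) (k : ℕ) : Measurable (X k) :=
  (h.measurable_past_X le_rfl).mono (h.past_le k) le_rfl

theorem measurable_X_apply (h : Run P p F D L σ ς ρ γ τ x₀ w W ξ X) (k : ℕ) (i : Fin n) :
    Measurable fun ω => X k ω i :=
  (measurable_pi_apply i).comp (h.measurable_X k)

theorem measurable_past_gradStep (h : Run P p F D L σ ς ρ γ τ x₀ w W ξ X) {k l : ℕ} (hk : k < l) :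
    Measurable[past x₀ (stepVars w W ξ) l] (gradStep F τ w ξ X k) :=
  h.measurable_gradStep_of (h.measurable_past_X ((Nat.sub_le _ _).trans hk.le))
    (measurable_past _ _ hk)

theorem measurable_gradStep (h : Run P p F D L σ ς ρ γ τ x₀ w W ξ X) (k : ℕ) :
    Measurable (gradStep F τ w ξ X k) :=
  h.measurable_gradStep_of (h.measurable_X _) (h.measurable_stepVars k)

theorem measurable_localGrad (h : Run P p F D L σ ς ρ γ τ x₀ w W ξ X) (i : Fin n) :
    Measurable (∇ (localLoss F D i)) :=
  (h.loss.lipschitz_grad i).continuous.measurable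

theorem measurable_globalGrad (h : Run P p F D L σ ς ρ γ τ x₀ w W ξ X) :
    Measurable (∇ (globalLoss p F D)) :=
  h.loss.lipschitz_gradient_globalLoss.continuous.measurable

variable [IsProbabilityMeasure P]

theorem indep (h : Run P p F D L σ ς ρ γ τ x₀ w W ξ X) (k : ℕ) :
    Indep (past x₀ (stepVars w W ξ) k) (future (stepVars w W ξ) k) P :=
  indep_past_future h.sampling.measurable_init h.measurable_stepVars h.sampling.indep_steps
    h.sampling.indep_init k

theorem measurable_future_sample (k : ℕ) :
    Measurable[future (stepVars w W ξ) k] fun ω => (w k ω, ξ k ω) := by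
  have h1 : Measurable[future (stepVars w W ξ) k] (stepVars w W ξ k) := measurable_future _ le_rfl
  exact h1.fst.prodMk h1.snd.snd

theorem lintegral_gradStep_le (h : Run P p F D L σ ς ρ γ τ x₀ w W ξ X) (k : ℕ) :
    ∫⁻ ω, ENNReal.ofReal (‖gradStep F τ w ξ X k ω‖ ^ 2) ∂P ≤
      ∫⁻ ω, ENNReal.ofReal (M * σ ^ 2 +
        M ^ 2 * ∑ i, p i * ‖∇ (localLoss F D i) (X (k - τ k) ω i)‖ ^ 2) ∂P := by
  have hind : IndepFun (X (k - τ k)) (fun ω => (w k ω, ξ k ω)) P :=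
    IndepFun.of_indep (h.indep k) (h.measurable_past_X (Nat.sub_le _ _))
      (measurable_future_sample k)
  have hψ : Measurable fun q : (Fin n → EuclideanSpace ℝ (Fin N)) × Fin n × (Fin n → Fin M → Ξ) =>
      ENNReal.ofReal (‖batchGrad F q.1 q.2.1 q.2.2‖ ^ 2) :=
    (h.loss.measurable_batchGrad.norm.pow_const 2).ennreal_ofReal
  have h1 := lintegral_comp_of_indepFun (h.measurable_X _)
    ((h.sampling.measurable_worker k).prodMk (h.sampling.measurable_sample k)) hind
    (ψ := fun y q => ENNReal.ofReal (‖batchGrad F y q.1 q.2‖ ^ 2)) hψ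
  refine h1.le.trans (lintegral_mono fun ω => ?_)
  exact (h.loss.batchGrad_worker_moments (h.sampling.measurable_worker k)
    (h.sampling.law_worker k) (h.sampling.measurable_sample k) (h.sampling.law_sample k)
    (h.sampling.indep_samples k) (h.sampling.indep_worker_sample k) (X (k - τ k) ω)).2.2

/-- Conditionally on the past, `∂g` is an unbiased estimate of the weighted gradient. -/
theorem integral_inner_gradStep (h : Run P p F D L σ ς ρ γ τ x₀ w W ξ X) {k : ℕ}
    {V : Ω → EuclideanSpace ℝ (Fin N)} (hV : Measurable[past x₀ (stepVars w W ξ) k] V)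
    (hVL : MemLp V 2 P) (hG : MemLp (gradStep F τ w ξ X k) 2 P) :
    ∫ ω, inner ℝ (V ω) (gradStep F τ w ξ X k ω) ∂P =
      M * ∫ ω, inner ℝ (V ω) (∑ i, p i • ∇ (localLoss F D i) (X (k - τ k) ω i)) ∂P := by
  have hXp := h.measurable_past_X (Nat.sub_le k (τ k))
  have hind : IndepFun (fun ω => (V ω, X (k - τ k) ω)) (fun ω => (w k ω, ξ k ω)) P :=
    IndepFun.of_indep (h.indep k) (hV.prodMk hXp) (measurable_future_sample k)
  have h0 : Measurable fun q : (EuclideanSpace ℝ (Fin N) × (Fin n → EuclideanSpace ℝ (Fin N))) ×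
      Fin n × (Fin n → Fin M → Ξ) => batchGrad F q.1.2 q.2.1 q.2.2 := by
    have h1 := h.loss.measurable_batchGrad.comp
      (measurable_fst.snd.prodMk measurable_snd : Measurable fun q : (EuclideanSpace ℝ (Fin N) ×
        (Fin n → EuclideanSpace ℝ (Fin N))) × Fin n × (Fin n → Fin M → Ξ) => (q.1.2, q.2))
    exact h1
  have hψ : Measurable fun q : (EuclideanSpace ℝ (Fin N) × (Fin n → EuclideanSpace ℝ (Fin N))) ×
      Fin n × (Fin n → Fin M → Ξ) =>
      (inner ℝ q.1.1 (batchGrad F q.1.2 q.2.1 q.2.2) : ℝ) := measurable_fst.fst.inner h0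
  have h1 := integral_comp_of_indepFun
    ((hV.mono (h.past_le k) le_rfl).prodMk (h.measurable_X _))
    ((h.sampling.measurable_worker k).prodMk (h.sampling.measurable_sample k)) hind
    (ψ := fun y q => inner ℝ y.1 (batchGrad F y.2 q.1 q.2)) hψ.stronglyMeasurable
    (hVL.integrable_inner_two hG)
  refine h1.trans ?_
  rw [← integral_const_mul]
  refine integral_congr_ae (Filter.Eventually.of_forall fun ω => ?_)
  have hmom := h.loss.batchGrad_worker_moments (h.sampling.measurable_worker k)
    (h.sampling.law_worker k) (h.sampling.measurable_sample k) (h.sampling.law_sample k)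
    (h.sampling.indep_samples k) (h.sampling.indep_worker_sample k) (X (k - τ k) ω)
  have h2 := integral_inner (𝕜 := ℝ) (hmom.1.integrable one_le_two) (V ω)
  rw [hmom.2.1, inner_smul_right] at h2
  exact h2

theorem memLp_globalGrad_init (h : Run P p F D L σ ς ρ γ τ x₀ w W ξ X) :
    MemLp (fun ω => ∇ (globalLoss p F D) (x₀ ω)) 2 P := by
  obtain ⟨m, hm⟩ := h.loss.bddBelow
  have hm' : ∀ x, m ≤ globalLoss p F D x := fun x => hm ⟨x, rfl⟩
  have h1 : Measurable fun ω => ∇ (globalLoss p F D) (x₀ ω) :=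
    h.measurable_globalGrad.comp h.sampling.measurable_init
  rw [memLp_two_iff_integrable_sq_norm h1.aestronglyMeasurable]
  refine ((h.integrable_init.sub (integrable_const m)).const_mul (2 * ((L : ℝ) + 1))).mono'
    (h1.norm.pow_const 2).aestronglyMeasurable (Filter.Eventually.of_forall fun ω => ?_)
  rw [Real.norm_of_nonneg (sq_nonneg _)]
  exact norm_gradient_sq_le h.loss.differentiable_globalLoss
    h.loss.lipschitz_gradient_globalLoss hm' (x₀ ω)

theorem memLp_globalGrad_of (h : Run P p F D L σ ς ρ γ τ x₀ w W ξ X)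
    {V : Ω → EuclideanSpace ℝ (Fin N)} (hV : Measurable V)
    (hVL : MemLp (fun ω => V ω - x₀ ω) 2 P) :
    MemLp (fun ω => ∇ (globalLoss p F D) (V ω)) 2 P := by
  have hm := h.measurable_globalGrad
  have h1 : MemLp (fun ω => ∇ (globalLoss p F D) (V ω) - ∇ (globalLoss p F D) (x₀ ω)) 2 P :=
    hVL.of_le_mul (c := L)
      ((hm.comp hV).sub (hm.comp h.sampling.measurable_init)).aestronglyMeasurable
      (Filter.Eventually.of_forall fun ω =>
        h.loss.lipschitz_gradient_globalLoss.norm_sub_le (V ω) (x₀ ω))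
  have h2 := h1.add h.memLp_globalGrad_init
  refine (memLp_congr_ae (Filter.Eventually.of_forall fun ω => ?_)).1 h2
  simp

/-- The weighted heterogeneity bound keeps the local gradient within `√(ς² / p i)` of the global
one. It says nothing about workers of weight zero, which is why later statements carry the factor `p
i`. -/
theorem memLp_localGrad_of (h : Run P p F D L σ ς ρ γ τ x₀ w W ξ X) {i : Fin n} (hi : p i ≠ 0)
    {V : Ω → EuclideanSpace ℝ (Fin N)} (hV : Measurable V)
    (hVL : MemLp (fun ω => V ω - x₀ ω) 2 P) :
    MemLp (fun ω => ∇ (localLoss F D i) (V ω)) 2 P := by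
  have hm := h.measurable_globalGrad
  have hmi := h.measurable_localGrad i
  have hpi : 0 < p i := lt_of_le_of_ne (h.loss.weight_nonneg i) hi.symm
  have h1 : MemLp (fun ω => ∇ (localLoss F D i) (V ω) - ∇ (globalLoss p F D) (V ω)) 2 P := by
    refine MemLp.of_bound ((hmi.comp hV).sub (hm.comp hV)).aestronglyMeasurable
      (√(ς ^ 2 / p i)) (Filter.Eventually.of_forall fun ω => ?_)
    refine Real.le_sqrt_of_sq_le ?_
    rw [le_div_iff₀ hpi, mul_comm]
    exact (Finset.single_le_sum
      (f := fun i => p i * ‖∇ (localLoss F D i) (V ω) - ∇ (globalLoss p F D) (V ω)‖ ^ 2)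
      (fun j _ => mul_nonneg (h.loss.weight_nonneg j) (sq_nonneg _)) (Finset.mem_univ i)).trans
      (h.loss.worker_variance_le (V ω))
  have h2 := h1.add (h.memLp_globalGrad_of hV hVL)
  refine (memLp_congr_ae (Filter.Eventually.of_forall fun ω => ?_)).1 h2
  simp

theorem integrable_weight_localGrad_sq_of (h : Run P p F D L σ ς ρ γ τ x₀ w W ξ X) (i : Fin n)
    {V : Ω → EuclideanSpace ℝ (Fin N)} (hV : Measurable V)
    (hVL : MemLp (fun ω => V ω - x₀ ω) 2 P) :
    Integrable (fun ω => p i * ‖∇ (localLoss F D i) (V ω)‖ ^ 2) P := by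
  by_cases hi : p i = 0
  · simp [hi]
  · exact (h.memLp_localGrad_of hi hV hVL).integrable_norm_sq.const_mul _

theorem memLp_gradStep_of (h : Run P p F D L σ ς ρ γ τ x₀ w W ξ X) {k : ℕ}
    (hX : ∀ i, MemLp (fun ω => X (k - τ k) ω i - x₀ ω) 2 P) :
    MemLp (gradStep F τ w ξ X k) 2 P := by
  refine memLp_two_of_lintegral_ne_top (h.measurable_gradStep k).aestronglyMeasurable
    (ne_top_of_le_ne_top ?_ (h.lintegral_gradStep_le k))
  refine (Integrable.lintegral_lt_top ?_).ne
  exact (integrable_const _).add ((integrable_finsetSum _ fun i _ =>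
    h.integrable_weight_localGrad_sq_of i (h.measurable_X_apply _ i) (hX i)).const_mul _)

/-- Strong induction, since the update at step `k` reads the iterate `k - τ k`. The columns of the
averaging matrix sum to one, so subtracting the initial model commutes with averaging. -/
theorem memLp_X_sub (h : Run P p F D L σ ς ρ γ τ x₀ w W ξ X) (k : ℕ) (i : Fin n) :
    MemLp (fun ω => X k ω i - x₀ ω) 2 P := by
  induction k using Nat.strong_induction_on generalizing i with
  | _ k ih =>
    rcases k with _ | k
    · simp [h.X_zero]
    · have hG := h.memLp_gradStep_of (k := k) fun i => ih _ (by omega) i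
      have h1 : ∀ᵐ ω ∂P, (∑ j, W k ω j i • (X k ω j - x₀ ω)) -
          γ • (if i = w k ω then gradStep F τ w ξ X k ω else 0) = X (k + 1) ω i - x₀ ω := by
        filter_upwards [h.sampling.doublyStochastic k] with ω hω
        rw [h.X_succ]
        simp_rw [smul_sub]
        rw [Finset.sum_sub_distrib, ← Finset.sum_smul, sum_col_of_mem_doublyStochastic hω, one_smul]
        abel
      refine (memLp_congr_ae h1).1 (MemLp.sub (memLp_finsetSum _ fun j _ => ?_)
        (MemLp.const_smul ?_ γ))
      · refine (ih k (by omega) j).of_le ((h.sampling.measurable_matrix k j i).smul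
          ((h.measurable_X_apply k j).sub h.sampling.measurable_init)).aestronglyMeasurable ?_
        filter_upwards [h.sampling.doublyStochastic k] with ω hω
        rw [norm_smul, Real.norm_of_nonneg (nonneg_of_mem_doublyStochastic hω)]
        exact mul_le_of_le_one_left (norm_nonneg _) (le_one_of_mem_doublyStochastic hω)
      · refine hG.of_le (Measurable.ite ?_ (h.measurable_gradStep k)
          measurable_const).aestronglyMeasurable (Filter.Eventually.of_forall fun ω => ?_)
        · have h4 := h.sampling.measurable_worker k (measurableSet_singleton i)
          convert h4 using 1
          ext ω
          simp [eq_comm]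
        · split_ifs <;> simp

theorem memLp_gradStep (h : Run P p F D L σ ς ρ γ τ x₀ w W ξ X) (k : ℕ) :
    MemLp (gradStep F τ w ξ X k) 2 P :=
  h.memLp_gradStep_of fun i => h.memLp_X_sub _ i

theorem memLp_meanModel_sub (h : Run P p F D L σ ς ρ γ τ x₀ w W ξ X) (k : ℕ) :
    MemLp (fun ω => meanModel (X k ω) - x₀ ω) 2 P := by
  have hn : (n : ℝ) ≠ 0 := by exact_mod_cast h.nonempty_workers.ne'
  have h1 : ∀ ω, (n : ℝ)⁻¹ • ∑ i, (X k ω i - x₀ ω) = meanModel (X k ω) - x₀ ω := fun ω => by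
    rw [meanModel, Finset.sum_sub_distrib, smul_sub]
    simp [← Nat.cast_smul_eq_nsmul ℝ, smul_smul, hn]
  simp_rw [← h1]
  exact (memLp_finsetSum _ fun i _ => h.memLp_X_sub k i).const_smul (n : ℝ)⁻¹

theorem memLp_X_sub_meanModel (h : Run P p F D L σ ς ρ γ τ x₀ w W ξ X) (k : ℕ) (i : Fin n) :
    MemLp (fun ω => X k ω i - meanModel (X k ω)) 2 P := by
  have := (h.memLp_X_sub k i).sub (h.memLp_meanModel_sub k)
  refine (memLp_congr_ae (Filter.Eventually.of_forall fun ω => ?_)).1 this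
  simp

theorem memLp_globalGrad_meanModel (h : Run P p F D L σ ς ρ γ τ x₀ w W ξ X) (k : ℕ) :
    MemLp (fun ω => ∇ (globalLoss p F D) (meanModel (X k ω))) 2 P :=
  h.memLp_globalGrad_of (measurable_meanModel (h.measurable_X k)) (h.memLp_meanModel_sub k)

theorem memLp_weightedGrad (h : Run P p F D L σ ς ρ γ τ x₀ w W ξ X) (k : ℕ) :
    MemLp (fun ω => ∑ i, p i • ∇ (localLoss F D i) (X k ω i)) 2 P := by
  refine memLp_finsetSum _ fun i _ => ?_
  by_cases hi : p i = 0
  · simp [hi]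
  · exact (h.memLp_localGrad_of hi (h.measurable_X_apply k i) (h.memLp_X_sub k i)).const_smul (p i)

end Run

end Trajectory

/-! ### Deviation of the local models from their mean -/

section Consensus

/-- Cauchy–Schwarz with weights `r j`. It replaces orthogonality: the summands are updates of
different steps, which are not independent. -/
theorem integral_norm_sum_sq_le {Ω ι E : Type*} {mΩ : MeasurableSpace Ω} {P : Measure Ω}
    [NormedAddCommGroup E] {s : Finset ι} {Y : ι → Ω → E} (hY : ∀ j ∈ s, MemLp (Y j) 2 P)
    {b r : ι → ℝ} (hr : ∀ j ∈ s, 0 ≤ r j)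
    (h : ∀ j ∈ s, ∫ ω, ‖Y j ω‖ ^ 2 ∂P ≤ b j * r j ^ 2) :
    ∫ ω, ‖∑ j ∈ s, Y j ω‖ ^ 2 ∂P ≤ (∑ j ∈ s, r j) * ∑ j ∈ s, b j * r j := by
  -- A zero weight, as occurs for `ρ = 0`, forces the summand to vanish, so the division by `r j`
  -- below is harmless.
  have h0 : ∀ᵐ ω ∂P, ∀ j ∈ s, r j = 0 → Y j ω = 0 := by
    rw [Filter.eventually_all_finset]
    intro j hj
    by_cases hrj : r j = 0
    · have h1 : ∫ ω, ‖Y j ω‖ ^ 2 ∂P = 0 := le_antisymm ((h j hj).trans (by simp [hrj]))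
        (integral_nonneg fun ω => sq_nonneg _)
      rw [integral_eq_zero_iff_of_nonneg (fun ω => sq_nonneg _) (hY j hj).integrable_norm_sq] at h1
      filter_upwards [h1] with ω hω _
      simpa using hω
    · exact Filter.Eventually.of_forall fun ω h2 => absurd h2 hrj
  have hi : ∀ j ∈ s, Integrable (fun ω => ‖Y j ω‖ ^ 2 / r j) P := fun j hj =>
    (hY j hj).integrable_norm_sq.div_const _
  calc ∫ ω, ‖∑ j ∈ s, Y j ω‖ ^ 2 ∂P
      ≤ ∫ ω, (∑ j ∈ s, r j) * ∑ j ∈ s, ‖Y j ω‖ ^ 2 / r j ∂P := by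
        refine integral_mono_ae (memLp_finsetSum _ hY).integrable_norm_sq
          ((integrable_finsetSum _ hi).const_mul _) ?_
        filter_upwards [h0] with ω hω
        refine (pow_le_pow_left₀ (norm_nonneg _) (norm_sum_le _ _) 2).trans ?_
        refine Finset.sum_sq_le_sum_mul_sum_of_sq_le_mul s hr
          (fun j hj => div_nonneg (sq_nonneg _) (hr j hj)) fun j hj => ?_
        by_cases hrj : r j = 0
        · simp [hω j hj hrj]
        · exact (mul_div_cancel₀ _ hrj).ge
    _ = (∑ j ∈ s, r j) * ∑ j ∈ s, (∫ ω, ‖Y j ω‖ ^ 2 ∂P) / r j := by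
        rw [integral_const_mul, integral_finsetSum _ hi]
        simp_rw [integral_div]
    _ ≤ _ := by
        refine mul_le_mul_of_nonneg_left (Finset.sum_le_sum fun j hj => ?_) (Finset.sum_nonneg hr)
        rcases (hr j hj).eq_or_lt with hrj | hrj
        · simp [← hrj]
        · rw [div_le_iff₀ hrj]
          linarith [h j hj, sq (r j)]

theorem geom_sum_le_inv_one_sub {r : ℝ} (hr0 : 0 ≤ r) (hr1 : r < 1) (k : ℕ) :
    ∑ j ∈ Finset.range k, r ^ j ≤ (1 - r)⁻¹ := by
  rw [← tsum_geometric_of_lt_one hr0 hr1]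
  exact (summable_geometric_of_lt_one hr0 hr1).sum_le_tsum _ fun j _ => pow_nonneg hr0 j

/-- The vector `e_i - 1_n / n`. -/
def devVec (n : ℕ) (i a : Fin n) : ℝ := (if a = i then 1 else 0) - (n : ℝ)⁻¹

theorem sum_devVec {n : ℕ} (i : Fin n) : ∑ a, devVec n i a = 0 := by
  have hn : (n : ℝ) ≠ 0 := by exact_mod_cast (i.pos).ne'
  simp [devVec, Finset.sum_sub_distrib, hn]

theorem sum_devVec_sq {n : ℕ} (i : Fin n) : ∑ a, devVec n i a ^ 2 = ((n : ℝ) - 1) / n := by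
  have hn : (n : ℝ) ≠ 0 := by exact_mod_cast (i.pos).ne'
  have h1 : ∀ a, devVec n i a ^ 2 =
      (if a = i then 1 - 2 * (n : ℝ)⁻¹ else 0) + (n : ℝ)⁻¹ ^ 2 := fun a => by
    unfold devVec
    split_ifs <;> ring
  simp_rw [h1]
  rw [Finset.sum_add_distrib]
  simp
  field_simp
  ring

variable {n N M : ℕ} {Ξ Ω : Type*} [MeasurableSpace Ξ] {mΩ : MeasurableSpace Ω}

theorem sum_devVec_smul (Y : Fin n → EuclideanSpace ℝ (Fin N)) (i : Fin n) :
    ∑ a, devVec n i a • Y a = Y i - meanModel Y := by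
  simp [devVec, sub_smul, Finset.sum_sub_distrib, meanModel, Finset.smul_sum]

variable {P : Measure Ω}
  {p : Fin n → ℝ} {F : Fin n → EuclideanSpace ℝ (Fin N) → Ξ → ℝ} {D : Fin n → Measure Ξ}
  {L : ℝ≥0} {σ ς ρ γ : ℝ} {τ : ℕ → ℕ}
  {x₀ : Ω → EuclideanSpace ℝ (Fin N)} {w : ℕ → Ω → Fin n}
  {W : ℕ → Ω → Matrix (Fin n) (Fin n) ℝ} {ξ : ℕ → Ω → Fin n → Fin M → Ξ}
  {X : ℕ → Ω → Fin n → EuclideanSpace ℝ (Fin N)}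

namespace Run

theorem ae_doublyStochastic (h : Run P p F D L σ ς ρ γ τ x₀ w W ξ X) :
    ∀ᵐ ω ∂P, ∀ l, W l ω ∈ doublyStochastic ℝ (Fin n) :=
  ae_all_iff.2 h.sampling.doublyStochastic

/-- Moving `u` one step back in time turns it into `W k *ᵥ u`, again of sum zero, and releases the
update of step `k` with the coefficient `-γ * u (w k)`. At time 0 all columns agree, so nothing
remains. -/
theorem sum_smul_X (h : Run P p F D L σ ς ρ γ τ x₀ w W ξ X) {ω : Ω}
    (hW : ∀ l, W l ω ∈ doublyStochastic ℝ (Fin n)) (k : ℕ) {u : Fin n → ℝ} (hu : ∑ a, u a = 0) :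
    ∑ a, u a • X k ω a = ∑ j ∈ Finset.range k,
      (-γ * mixVec (fun l => W l ω) u (j + 1) (k - 1 - j) (w j ω)) • gradStep F τ w ξ X j ω := by
  induction k generalizing u with
  | zero => simp [h.X_zero, ← Finset.sum_smul, hu]
  | succ k ih =>
    have h1 := ih (u := (W k ω).mulVec u)
      ((sum_mulVec_of_mem_doublyStochastic (hW k)).trans hu)
    rw [Finset.sum_range_succ]
    have h2 : ∑ a, u a • X (k + 1) ω a =
        ∑ a, (W k ω).mulVec u a • X k ω a - γ • u (w k ω) • gradStep F τ w ξ X k ω := by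
      simp_rw [h.X_succ, smul_sub]
      rw [Finset.sum_sub_distrib]
      congr 1
      · simp_rw [Finset.smul_sum, Matrix.mulVec, dotProduct, Finset.sum_smul]
        rw [Finset.sum_comm]
        exact Finset.sum_congr rfl fun a _ => Finset.sum_congr rfl fun b _ => by
          rw [smul_smul, mul_comm]
      · rw [Finset.sum_eq_single (w k ω)]
        · rw [if_pos rfl, smul_comm]
        · intro b _ hb
          simp [hb]
        · simp
    rw [h2, h1, sub_eq_add_neg]
    congr 1
    · refine Finset.sum_congr rfl fun j hj => ?_
      have hj' := Finset.mem_range.1 hj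
      have h3 : k + 1 - 1 - j = (k - 1 - j) + 1 := by omega
      have h4 : j + 1 + (k - 1 - j) = k := by omega
      rw [h3, mixVec_succ_right, h4]
    · have h5 : k + 1 - 1 - k = 0 := by omega
      rw [h5, mixVec, smul_smul, neg_mul, neg_smul]

variable [IsProbabilityMeasure P]

theorem measurable_future_mixVec (u : Fin n → ℝ) (a m : ℕ) :
    Measurable[future (stepVars w W ξ) a] fun ω => mixVec (fun l => W l ω) u a m := by
  refine measurable_mixVec (fun l hl i j => ?_) u m
  have h1 := (measurable_pi_apply j).comp ((measurable_pi_apply i).comp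
    (measurable_future (stepVars w W ξ) hl).snd.fst)
  exact h1

theorem integral_sum_sq_mix_le (h : Run P p F D L σ ς ρ γ τ x₀ w W ξ X) {u : Fin n → ℝ}
    (hu : ∑ i, u i = 0) (a m : ℕ) :
    ∫ ω, ∑ i, mixVec (fun l => W l ω) u a m i ^ 2 ∂P ≤ ρ ^ m * ∑ i, u i ^ 2 := by
  refine integral_sum_sq_mixVec_le h.sampling.measurable_matrix h.sampling.doublyStochastic
    h.rho_nonneg h.rho_lt_one h.sampling.spectralGap hu (fun a m => ?_) a m
  exact IndepFun.of_indep (h.indep (a + 1))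
    (measurable_past x₀ (stepVars w W ξ) (Nat.lt_succ_self a)).snd.fst
    (measurable_future_mixVec u (a + 1) m)

theorem memLp_mix_smul_gradStep (h : Run P p F D L σ ς ρ γ τ x₀ w W ξ X) (u : Fin n → ℝ)
    (j m : ℕ) : MemLp (fun ω =>
      (-γ * mixVec (fun l => W l ω) u (j + 1) m (w j ω)) • gradStep F τ w ξ X j ω) 2 P := by
  have hmix : Measurable fun ω => mixVec (fun l => W l ω) u (j + 1) m :=
    measurable_mixVec (fun l _ => h.sampling.measurable_matrix l) u m
  have hmixw : Measurable fun ω => mixVec (fun l => W l ω) u (j + 1) m (w j ω) := by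
    have h1 : Measurable fun q : (Fin n → ℝ) × Fin n => q.1 q.2 :=
      measurable_from_prod_countable_left fun i => measurable_pi_apply i
    exact h1.comp (hmix.prodMk (h.sampling.measurable_worker j))
  refine (h.memLp_gradStep j).of_le_mul (c := |γ| * ∑ i, |u i|)
    ((hmixw.const_mul (-γ)).fun_smul (h.measurable_gradStep j)).aestronglyMeasurable ?_
  filter_upwards [h.ae_doublyStochastic] with ω hω
  rw [norm_smul, norm_mul, norm_neg]
  refine mul_le_mul_of_nonneg_right (mul_le_mul_of_nonneg_left ?_ (abs_nonneg γ)) (norm_nonneg _)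
  exact abs_mixVec_le hω (fun i => Finset.single_le_sum (f := fun i => |u i|)
    (fun j _ => abs_nonneg (u j)) (Finset.mem_univ i)) (j + 1) m (w j ω)

/-- The update of step `j` enters after the mixing by `W j`, so only `W (j + 1), …` act on it, and
these are independent of everything up to step `j`. The matrix `W j`, which may depend on the worker
and the samples of its step, does not occur. -/
theorem integral_mix_smul_gradStep_sq_le (h : Run P p F D L σ ς ρ γ τ x₀ w W ξ X)
    {u : Fin n → ℝ} (hu : ∑ i, u i = 0) (j m : ℕ) :
    ∫ ω, ‖(-γ * mixVec (fun l => W l ω) u (j + 1) m (w j ω)) • gradStep F τ w ξ X j ω‖ ^ 2 ∂P ≤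
      (γ ^ 2 * (∑ i, u i ^ 2) * ∫ ω, ‖gradStep F τ w ξ X j ω‖ ^ 2 ∂P) * (√ρ ^ m) ^ 2 := by
  have hφ : Measurable fun v : Fin n → ℝ => ∑ i, v i ^ 2 := by fun_prop
  have hmix : Measurable fun ω => mixVec (fun l => W l ω) u (j + 1) m :=
    measurable_mixVec (fun l _ => h.sampling.measurable_matrix l) u m
  have hmix2 : Measurable fun ω => ∑ i, mixVec (fun l => W l ω) u (j + 1) m i ^ 2 := hφ.comp hmix
  have hind : IndepFun (fun ω => ‖gradStep F τ w ξ X j ω‖ ^ 2)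
      (fun ω => ∑ i, mixVec (fun l => W l ω) u (j + 1) m i ^ 2) P :=
    IndepFun.of_indep (h.indep (j + 1))
      ((measurable_norm.pow_const 2).comp (h.measurable_past_gradStep (Nat.lt_succ_self j)))
      (hφ.comp (measurable_future_mixVec u (j + 1) m))
  have hGi := (h.memLp_gradStep j).integrable_norm_sq
  have hmixi : Integrable (fun ω => ∑ i, mixVec (fun l => W l ω) u (j + 1) m i ^ 2) P := by
    refine Integrable.of_bound hmix2.aestronglyMeasurable (∑ _i : Fin n, (∑ i, |u i|) ^ 2) ?_
    filter_upwards [h.ae_doublyStochastic] with ω hω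
    rw [Real.norm_of_nonneg (Finset.sum_nonneg fun i _ => sq_nonneg _)]
    refine Finset.sum_le_sum fun i _ => ?_
    rw [← sq_abs]
    exact pow_le_pow_left₀ (abs_nonneg _) (abs_mixVec_le hω (fun i =>
      Finset.single_le_sum (f := fun i => |u i|) (fun j _ => abs_nonneg (u j))
        (Finset.mem_univ i)) (j + 1) m i) 2
  calc ∫ ω, ‖(-γ * mixVec (fun l => W l ω) u (j + 1) m (w j ω)) • gradStep F τ w ξ X j ω‖ ^ 2 ∂P
      ≤ ∫ ω, γ ^ 2 * (‖gradStep F τ w ξ X j ω‖ ^ 2 *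
          ∑ i, mixVec (fun l => W l ω) u (j + 1) m i ^ 2) ∂P := by
        refine integral_mono (h.memLp_mix_smul_gradStep u j m).integrable_norm_sq
          ((hind.integrable_mul hGi hmixi).const_mul _) fun ω => ?_
        beta_reduce
        rw [norm_smul, mul_pow, norm_mul, mul_pow, norm_neg, Real.norm_eq_abs, Real.norm_eq_abs,
          sq_abs, sq_abs, mul_assoc, mul_comm (_ ^ 2) (‖_‖ ^ 2)]
        gcongr
        -- The entry at the random worker is bounded by the sum over all entries, which no longer
        -- involves the past.
        exact Finset.single_le_sum (f := fun i => mixVec (fun l => W l ω) u (j + 1) m i ^ 2)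
          (fun i _ => sq_nonneg _) (Finset.mem_univ (w j ω))
    _ = γ ^ 2 * ((∫ ω, ‖gradStep F τ w ξ X j ω‖ ^ 2 ∂P) *
          ∫ ω, ∑ i, mixVec (fun l => W l ω) u (j + 1) m i ^ 2 ∂P) := by
        rw [integral_const_mul, hind.integral_fun_mul_eq_mul_integral hGi.1 hmixi.1]
    _ ≤ γ ^ 2 * ((∫ ω, ‖gradStep F τ w ξ X j ω‖ ^ 2 ∂P) * (ρ ^ m * ∑ i, u i ^ 2)) := by
        exact mul_le_mul_of_nonneg_left (mul_le_mul_of_nonneg_left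
          (h.integral_sum_sq_mix_le hu (j + 1) m) (integral_nonneg fun ω => sq_nonneg _))
          (sq_nonneg γ)
    _ = _ := by
        rw [← pow_mul, mul_comm m 2, pow_mul, Real.sq_sqrt h.rho_nonneg]
        ring

/-- Cauchy–Schwarz with the weights `√ρ ^ (k - 1 - j)`: one factor sums to at most `(1 - √ρ)⁻¹`, the
other remains as discount. -/
theorem integral_deviation_le (h : Run P p F D L σ ς ρ γ τ x₀ w W ξ X) (k : ℕ) (i : Fin n) :
    ∫ ω, ‖X k ω i - meanModel (X k ω)‖ ^ 2 ∂P ≤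
      γ ^ 2 * (((n : ℝ) - 1) / n) * (1 - √ρ)⁻¹ * ∑ j ∈ Finset.range k,
        (∫ ω, ‖gradStep F τ w ξ X j ω‖ ^ 2 ∂P) * √ρ ^ (k - 1 - j) := by
  have hr0 : 0 ≤ √ρ := Real.sqrt_nonneg ρ
  have hr1 : √ρ < 1 := by
    rw [Real.sqrt_lt' one_pos]
    simpa using h.rho_lt_one
  have hn : (1 : ℝ) ≤ n := by exact_mod_cast h.nonempty_workers
  have h1 := integral_norm_sum_sq_le (P := P) (s := Finset.range k)
    (fun j _ => h.memLp_mix_smul_gradStep (devVec n i) j (k - 1 - j))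
    (fun j _ => pow_nonneg hr0 (k - 1 - j))
    (fun j _ => h.integral_mix_smul_gradStep_sq_le (sum_devVec i) j (k - 1 - j))
  rw [sum_devVec_sq] at h1
  have h2 : ∀ᵐ ω ∂P, ‖X k ω i - meanModel (X k ω)‖ ^ 2 = ‖∑ j ∈ Finset.range k,
      (-γ * mixVec (fun l => W l ω) (devVec n i) (j + 1) (k - 1 - j) (w j ω)) •
        gradStep F τ w ξ X j ω‖ ^ 2 := h.ae_doublyStochastic.mono fun ω hω => by
    rw [← h.sum_smul_X hω k (sum_devVec i), sum_devVec_smul]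
  rw [integral_congr_ae h2]
  refine h1.trans ?_
  have h3 : ∑ j ∈ Finset.range k, √ρ ^ (k - 1 - j) ≤ (1 - √ρ)⁻¹ := by
    rw [Finset.sum_range_reflect (fun j => √ρ ^ j) k]
    exact geom_sum_le_inv_one_sub hr0 hr1 k
  have h4 : ∑ j ∈ Finset.range k, γ ^ 2 * (((n : ℝ) - 1) / n) *
        (∫ ω, ‖gradStep F τ w ξ X j ω‖ ^ 2 ∂P) * √ρ ^ (k - 1 - j) =
      γ ^ 2 * (((n : ℝ) - 1) / n) * ∑ j ∈ Finset.range k,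
        (∫ ω, ‖gradStep F τ w ξ X j ω‖ ^ 2 ∂P) * √ρ ^ (k - 1 - j) := by
    rw [Finset.mul_sum]
    exact Finset.sum_congr rfl fun j _ => by ring
  rw [h4]
  have h5 : 0 ≤ γ ^ 2 * (((n : ℝ) - 1) / n) * ∑ j ∈ Finset.range k,
      (∫ ω, ‖gradStep F τ w ξ X j ω‖ ^ 2 ∂P) * √ρ ^ (k - 1 - j) := by
    have : 0 ≤ (n : ℝ) - 1 := by linarith
    refine mul_nonneg (by positivity) (Finset.sum_nonneg fun j _ => mul_nonneg
      (integral_nonneg fun ω => sq_nonneg _) (pow_nonneg hr0 _))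
  calc _ ≤ (1 - √ρ)⁻¹ * (γ ^ 2 * (((n : ℝ) - 1) / n) * ∑ j ∈ Finset.range k,
        (∫ ω, ‖gradStep F τ w ξ X j ω‖ ^ 2 ∂P) * √ρ ^ (k - 1 - j)) :=
        mul_le_mul_of_nonneg_right h3 h5
    _ = _ := by ring

end Run

end Consensus

/-! ### Summation over the delays -/

section Delays

/-- After interchanging the sums, `g j` is counted only for `j < k ≤ j + T`. -/
theorem sum_delay_window_le {g : ℕ → ℝ} (hg : ∀ j, 0 ≤ g j) {τ : ℕ → ℕ} {T : ℕ}
    (hτT : ∀ k, τ k ≤ T) (K : ℕ) :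
    ∑ k ∈ Finset.range K, ∑ j ∈ Finset.Ico (k - τ k) k, g j ≤ T * ∑ j ∈ Finset.range K, g j := by
  calc ∑ k ∈ Finset.range K, ∑ j ∈ Finset.Ico (k - τ k) k, g j
      ≤ ∑ k ∈ Finset.range K, ∑ j ∈ Finset.range K, if k ∈ Finset.Ioc j (j + T) then g j else 0 := by
        refine Finset.sum_le_sum fun k hk => ?_
        rw [← Finset.sum_filter]
        refine Finset.sum_le_sum_of_subset_of_nonneg (fun j hj => ?_) fun j _ _ => hg j
        have h1 := Finset.mem_Ico.1 hj
        have h2 := Finset.mem_range.1 hk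
        have h3 := hτT k
        simp only [Finset.mem_filter, Finset.mem_range, Finset.mem_Ioc]
        omega
    _ = ∑ j ∈ Finset.range K, ∑ k ∈ Finset.range K,
          if k ∈ Finset.Ioc j (j + T) then g j else 0 := Finset.sum_comm
    _ ≤ ∑ j ∈ Finset.range K, T * g j := by
        refine Finset.sum_le_sum fun j _ => ?_
        rw [← Finset.sum_filter, Finset.sum_const, nsmul_eq_mul]
        refine mul_le_mul_of_nonneg_right ?_ (hg j)
        have h1 : (Finset.range K).filter (fun k => k ∈ Finset.Ioc j (j + T)) ⊆
            Finset.Ioc j (j + T) := fun k hk => (Finset.mem_filter.1 hk).2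
        have h2 := Finset.card_le_card h1
        rw [Nat.card_Ioc] at h2
        exact_mod_cast h2.trans (by omega)
    _ = _ := by rw [Finset.mul_sum]

/-- The `T` times in `(j, j + T]` contribute at most 1 each. Later, the exponent is at least `k - (j
+ T + 1)`, which leaves a geometric series. -/
theorem sum_delay_geom_le {r : ℝ} (hr0 : 0 ≤ r) (hr1 : r < 1) {τ : ℕ → ℕ} {T : ℕ}
    (hτT : ∀ k, τ k ≤ T) (K j : ℕ) :
    ∑ k ∈ Finset.range K, (if j < k - τ k then r ^ (k - τ k - 1 - j) else 0) ≤
      T + (1 - r)⁻¹ := by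
  calc ∑ k ∈ Finset.range K, (if j < k - τ k then r ^ (k - τ k - 1 - j) else 0)
      ≤ ∑ k ∈ Finset.range K, ((if k ∈ Finset.Ioc j (j + T) then 1 else 0) +
          if j + T + 1 ≤ k then r ^ (k - (j + T + 1)) else 0) := by
        refine Finset.sum_le_sum fun k _ => ?_
        have h3 := hτT k
        have hpos : ∀ m : ℕ, 0 ≤ r ^ m := fun m => pow_nonneg hr0 m
        by_cases h1 : j < k - τ k
        · rw [if_pos h1]
          by_cases h2 : j + T + 1 ≤ k
          · have h4 : k ∉ Finset.Ioc j (j + T) := by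
              rw [Finset.mem_Ioc]
              omega
            rw [if_pos h2, if_neg h4, zero_add]
            exact pow_le_pow_of_le_one hr0 hr1.le (by omega)
          · have h4 : k ∈ Finset.Ioc j (j + T) := by
              rw [Finset.mem_Ioc]
              omega
            rw [if_neg h2, if_pos h4, add_zero]
            exact pow_le_one₀ hr0 hr1.le
        · rw [if_neg h1]
          refine add_nonneg ?_ ?_
          · split_ifs
            exacts [zero_le_one, le_rfl]
          · split_ifs
            exacts [hpos _, le_rfl]
    _ = ∑ k ∈ Finset.range K, (if k ∈ Finset.Ioc j (j + T) then (1 : ℝ) else 0) +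
          ∑ k ∈ Finset.range K, (if j + T + 1 ≤ k then r ^ (k - (j + T + 1)) else 0) :=
        Finset.sum_add_distrib
    _ ≤ T + (1 - r)⁻¹ := by
        refine add_le_add ?_ ?_
        · rw [← Finset.sum_filter, Finset.sum_const, nsmul_eq_mul, mul_one]
          have h1 : (Finset.range K).filter (fun k => k ∈ Finset.Ioc j (j + T)) ⊆
              Finset.Ioc j (j + T) := fun k hk => (Finset.mem_filter.1 hk).2
          have h2 := Finset.card_le_card h1
          rw [Nat.card_Ioc] at h2
          exact_mod_cast h2.trans (by omega)
        · rw [← Finset.sum_filter]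
          have h1 : (Finset.range K).filter (fun k => j + T + 1 ≤ k) =
              Finset.Ico (j + T + 1) K := by
            ext k
            simp only [Finset.mem_filter, Finset.mem_range, Finset.mem_Ico]
            omega
          rw [h1, Finset.sum_Ico_eq_sum_range]
          refine le_trans (le_of_eq (Finset.sum_congr rfl fun i _ => ?_))
            (geom_sum_le_inv_one_sub hr0 hr1 (K - (j + T + 1)))
          rw [Nat.add_sub_cancel_left]

/-- A geometrically discounted sum of `g`, read with delays and summed over time. The constant part
`s` of the bound for `g` is not affected by the delays. -/
theorem sum_delay_discounted_le {g e : ℕ → ℝ} {s : ℝ} (hs : 0 ≤ s) (he : ∀ j, 0 ≤ e j)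
    (hge : ∀ j, g j ≤ s + e j) {r : ℝ} (hr0 : 0 ≤ r) (hr1 : r < 1) {τ : ℕ → ℕ} {T : ℕ}
    (hτT : ∀ k, τ k ≤ T) (K : ℕ) :
    ∑ k ∈ Finset.range K, ∑ j ∈ Finset.range (k - τ k), g j * r ^ (k - τ k - 1 - j) ≤
      K * s * (1 - r)⁻¹ + (T + (1 - r)⁻¹) * ∑ j ∈ Finset.range K, e j := by
  have h1 : ∀ k, ∑ j ∈ Finset.range (k - τ k), s * r ^ (k - τ k - 1 - j) ≤ s * (1 - r)⁻¹ := by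
    intro k
    rw [← Finset.mul_sum, Finset.sum_range_reflect (fun j => r ^ j) (k - τ k)]
    exact mul_le_mul_of_nonneg_left (geom_sum_le_inv_one_sub hr0 hr1 _) hs
  have h2 : ∑ k ∈ Finset.range K, ∑ j ∈ Finset.range (k - τ k), e j * r ^ (k - τ k - 1 - j) ≤
      (T + (1 - r)⁻¹) * ∑ j ∈ Finset.range K, e j := by
    calc ∑ k ∈ Finset.range K, ∑ j ∈ Finset.range (k - τ k), e j * r ^ (k - τ k - 1 - j)
        ≤ ∑ k ∈ Finset.range K, ∑ j ∈ Finset.range K,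
            e j * (if j < k - τ k then r ^ (k - τ k - 1 - j) else 0) := by
          refine Finset.sum_le_sum fun k hk => ?_
          simp_rw [mul_ite, mul_zero]
          rw [← Finset.sum_filter]
          refine Finset.sum_le_sum_of_subset_of_nonneg (fun j hj => ?_) fun j _ _ =>
            mul_nonneg (he j) (pow_nonneg hr0 _)
          have h1 := Finset.mem_range.1 hj
          have h2 := Finset.mem_range.1 hk
          simp only [Finset.mem_filter, Finset.mem_range]
          omega
      _ = ∑ j ∈ Finset.range K, e j * ∑ k ∈ Finset.range K,
            (if j < k - τ k then r ^ (k - τ k - 1 - j) else 0) := by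
          rw [Finset.sum_comm]
          simp_rw [Finset.mul_sum]
      _ ≤ ∑ j ∈ Finset.range K, e j * (T + (1 - r)⁻¹) :=
          Finset.sum_le_sum fun j _ =>
            mul_le_mul_of_nonneg_left (sum_delay_geom_le hr0 hr1 hτT K j) (he j)
      _ = _ := by rw [← Finset.sum_mul, mul_comm]
  calc ∑ k ∈ Finset.range K, ∑ j ∈ Finset.range (k - τ k), g j * r ^ (k - τ k - 1 - j)
      ≤ ∑ k ∈ Finset.range K, (s * (1 - r)⁻¹ +
          ∑ j ∈ Finset.range (k - τ k), e j * r ^ (k - τ k - 1 - j)) := by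
        refine Finset.sum_le_sum fun k _ => le_trans ?_ (add_le_add_left (h1 k) _)
        rw [← Finset.sum_add_distrib]
        refine Finset.sum_le_sum fun j _ => ?_
        rw [← add_mul]
        exact mul_le_mul_of_nonneg_right (hge j) (pow_nonneg hr0 _)
    _ ≤ _ := by
        rw [Finset.sum_add_distrib, Finset.sum_const, Finset.card_range, nsmul_eq_mul]
        linarith

end Delays

/-! ### The step size conditions -/

section Constants

variable {n M T : ℕ} {L γ ρ : ℝ}

theorem sqrt_lt_one_of_lt_one (hρ₁ : ρ < 1) : √ρ < 1 := by
  rw [Real.sqrt_lt' one_pos]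
  simpa using hρ₁

/-- With `r = √ρ`, the second factor of `rhoBar` exceeds `(1 - r)⁻²` by exactly `2r² / ((1 - r)²(1 +
r))`. -/
theorem div_sq_le_rhoBar (hn : 1 ≤ n) (hρ₀ : 0 ≤ ρ) (hρ₁ : ρ < 1) :
    ((n : ℝ) - 1) / n * ((1 - √ρ)⁻¹) ^ 2 ≤ rhoBar n ρ := by
  have hr0 := Real.sqrt_nonneg ρ
  have hr1 := sqrt_lt_one_of_lt_one hρ₁
  have hn' : (1 : ℝ) ≤ n := by exact_mod_cast hn
  have hR : 0 ≤ ((n : ℝ) - 1) / n := div_nonneg (by linarith) (by linarith)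
  unfold rhoBar
  refine mul_le_mul_of_nonneg_left ?_ hR
  have hρ : ρ = √ρ ^ 2 := (Real.sq_sqrt hρ₀).symm
  generalize √ρ = r at *
  subst hρ
  have h1 : 0 < 1 - r := by linarith
  have h2 : 0 < 1 + r := by linarith
  have h3 : 1 / (1 - r ^ 2) + 2 * r / (1 - r) ^ 2 - (1 - r)⁻¹ ^ 2 =
      2 * r ^ 2 / ((1 - r) ^ 2 * (1 + r)) := by
    have h4 : 1 - r ^ 2 = (1 - r) * (1 + r) := by ring
    rw [h4]
    field_simp
    ring
  have h5 : 0 ≤ 2 * r ^ 2 / ((1 - r) ^ 2 * (1 + r)) := by positivity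
  linarith

theorem rhoBar_nonneg (hn : 1 ≤ n) (hρ₀ : 0 ≤ ρ) (hρ₁ : ρ < 1) : 0 ≤ rhoBar n ρ := by
  refine le_trans ?_ (div_sq_le_rhoBar hn hρ₀ hρ₁)
  have hn' : (1 : ℝ) ≤ n := by exact_mod_cast hn
  have : 0 ≤ (n : ℝ) - 1 := by linarith
  positivity

theorem consensus_const_nonneg (hn : 1 ≤ n) (hρ₀ : 0 ≤ ρ) (hρ₁ : ρ < 1) :
    0 ≤ (T : ℝ) * (((n : ℝ) - 1) / n) + rhoBar n ρ := by
  have hn' : (1 : ℝ) ≤ n := by exact_mod_cast hn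
  have : 0 ≤ (n : ℝ) - 1 := by linarith
  have := rhoBar_nonneg hn hρ₀ hρ₁
  positivity

/-- Since `C₁ ≤ 1`, its inverse is at least 1; the other terms dropped are nonnegative. -/
theorem bound_of_C₃_le_one (hn : 1 ≤ n) (hL : 0 ≤ L) (hγ : 0 < γ) (hρ₀ : 0 ≤ ρ) (hρ₁ : ρ < 1)
    (hC₁ : 0 < C₁ n M T L γ ρ) (hC₃ : C₃ n M T L γ ρ ≤ 1) :
    γ * M * L * T ^ 2 / n + 2 * (γ * M * L * n * rhoBar n ρ) ≤ 1 / 2 := by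
  have hn' : (1 : ℝ) ≤ n := by exact_mod_cast hn
  have hb := rhoBar_nonneg hn hρ₀ hρ₁
  have hC₁' : C₁ n M T L γ ρ ≤ 1 := by
    have := consensus_const_nonneg (T := T) hn hρ₀ hρ₁
    unfold C₁
    have : 0 ≤ 24 * (M : ℝ) ^ 2 * L ^ 2 * γ ^ 2 *
      (T * (((n : ℝ) - 1) / n) + rhoBar n ρ) := by positivity
    linarith
  have hinv : 1 ≤ (C₁ n M T L γ ρ)⁻¹ := (one_le_inv₀ hC₁).2 hC₁'
  unfold C₃ at hC₃
  have h1 : 2 * 1 * (γ * n * M * L) * rhoBar n ρ ≤ 2 * (C₁ n M T L γ ρ)⁻¹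
      * (6 * γ ^ 2 * L ^ 2 * (M : ℝ) ^ 2 + γ * n * M * L
          + 12 * (M : ℝ) ^ 3 * L ^ 3 * (T : ℝ) ^ 2 * γ ^ 3 / n)
      * rhoBar n ρ := by
    gcongr
    have h2 : 0 ≤ 6 * γ ^ 2 * L ^ 2 * (M : ℝ) ^ 2 := by positivity
    have h3 : 0 ≤ 12 * (M : ℝ) ^ 3 * L ^ 3 * (T : ℝ) ^ 2 * γ ^ 3 / n := by positivity
    linarith
  have h4 : L * (T : ℝ) ^ 2 * γ * M / n = γ * M * L * T ^ 2 / n := by ring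
  rw [h4] at hC₃
  linarith

/-- The subtracted product in `C₂` is nonnegative, and the rest factors through `γ * M / n`. -/
theorem bound_of_C₂_nonneg (hn : 1 ≤ n) (hM : 1 ≤ M) (hL : 0 ≤ L) (hγ : 0 < γ) (hρ₀ : 0 ≤ ρ)
    (hρ₁ : ρ < 1) (hC₁ : 0 < C₁ n M T L γ ρ) (hC₂ : 0 ≤ C₂ n M T L γ ρ) :
    γ * M * L / n * (1 + 2 * (γ * M * L * T ^ 2 / n)) ≤ 1 / 2 := by
  have hn' : (0 : ℝ) < n := by exact_mod_cast hn
  have hM' : (0 : ℝ) < M := by exact_mod_cast hM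
  unfold C₂ at hC₂
  have h0 := consensus_const_nonneg (T := T) hn hρ₀ hρ₁
  have h1 : 0 ≤ (6 * γ ^ 2 * L ^ 3 * (M : ℝ) ^ 2 / (n : ℝ) ^ 2 + γ * M / n * L ^ 2
        + 12 * (M : ℝ) ^ 3 * L ^ 4 * (T : ℝ) ^ 2 * γ ^ 3 / (n : ℝ) ^ 3)
      * (4 * (M : ℝ) ^ 2 * γ ^ 2 * (T * (((n : ℝ) - 1) / n) + rhoBar n ρ) /
        C₁ n M T L γ ρ) := by positivity
  have h2 : 0 ≤ γ * M / (2 * n) - γ ^ 2 * L * (M : ℝ) ^ 2 / (n : ℝ) ^ 2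
    - 2 * (M : ℝ) ^ 3 * L ^ 2 * (T : ℝ) ^ 2 * γ ^ 3 / (n : ℝ) ^ 3 := by linarith
  have h3 : γ * M / (2 * n) - γ ^ 2 * L * (M : ℝ) ^ 2 / (n : ℝ) ^ 2
    - 2 * (M : ℝ) ^ 3 * L ^ 2 * (T : ℝ) ^ 2 * γ ^ 3 / (n : ℝ) ^ 3 =
    γ * M / n * (1 / 2 - γ * M * L / n * (1 + 2 * (γ * M * L * T ^ 2 / n))) := by
    field_simp
    ring
  rw [h3] at h2
  have h4 := nonneg_of_mul_nonneg_right h2 (by positivity : 0 < γ * M / n)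
  linarith

/-- The feedback of the deviation of the local models on itself is small. -/
theorem feedback_le {u R v t : ℝ} (hn : 2 ≤ n) (hu : 0 ≤ u) (hv : 1 ≤ v)
    (hR : R = ((n : ℝ) - 1) / n)
    (h : u * t ^ 2 / n + 2 * (u * n * (R * v ^ 2)) ≤ 1 / 2) :
    u ^ 2 * (R * v) * (t + v) ≤ 1 / 10 := by
  have hn' : (2 : ℝ) ≤ n := by exact_mod_cast hn
  have hR0 : 0 ≤ R := by rw [hR]; exact div_nonneg (by linarith) (by linarith)
  have hR1 : R ≤ 1 := by rw [hR, div_le_one (by linarith)]; linarith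
  have hnR : n * R = n - 1 := by rw [hR]; field_simp
  set a := u * t ^ 2 / n with ha
  set b := u * n * (R * v ^ 2) with hb
  have ha0 : 0 ≤ a := by positivity
  have hb0 : 0 ≤ b := by positivity
  have hb1 : b ≤ 1 / 4 := by linarith
  -- Here `n ≥ 2` enters, through `n * R = n - 1 ≥ 1`.
  have hub : u ≤ b := by
    have h1 : 1 ≤ (n * R) * v ^ 2 := by
      rw [hnR]
      nlinarith
    calc u = u * 1 := (mul_one u).symm
      _ ≤ u * ((n * R) * v ^ 2) := mul_le_mul_of_nonneg_left h1 hu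
      _ = b := by rw [hb]; ring
  -- AM–GM for `a` and `2 * b`, whose sum is at most `1 / 2`.
  have hab : a * b ≤ 1 / 32 := by nlinarith [sq_nonneg (a - 2 * b), sq_nonneg (a + 2 * b)]
  have h1 : u ^ 2 * (R * v) * v ≤ 1 / 32 := by
    have h2 : u ^ 2 * (R * v) * v = b * u / n := by
      rw [hb]
      field_simp
    rw [h2, div_le_iff₀ (by linarith)]
    nlinarith
  have h3 : u ^ 2 * (R * v) * t ≤ 1 / 20 := by
    -- `t` occurs in `a` only as a square, so this term is estimated through its square; `1 / 512 ≤
    -- 1 / 400`.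
    have h4 : (u ^ 2 * (R * v) * t) ^ 2 = u ^ 2 * R * (a * b) := by
      rw [ha, hb]
      field_simp
    have h5 : u ^ 2 * R ≤ 1 / 16 := by
      have : u ^ 2 ≤ 1 / 16 := by nlinarith
      nlinarith [sq_nonneg u]
    have h6 : (u ^ 2 * (R * v) * t) ^ 2 ≤ (1 / 20) ^ 2 := by
      rw [h4]
      have : u ^ 2 * R * (a * b) ≤ 1 / 16 * (1 / 32) :=
        mul_le_mul h5 hab (mul_nonneg ha0 hb0) (by norm_num)
      linarith
    exact le_of_sq_le_sq h6 (by norm_num)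
  linarith [mul_add (u ^ 2 * (R * v)) t v]

/-- Combination of the summed descent inequality with the summed bounds on the delay error `d`, on
the second moments `G` of the updates and on the deviation `Q` of the local models. -/
theorem sum_sq_gradient_le_of_bounds (hn : 1 ≤ n) (hM : 1 ≤ M) (hL : 0 ≤ L) (hγ : 0 < γ)
    (hρ₀ : 0 ≤ ρ) (hρ₁ : ρ < 1) (hC₁ : 0 < C₁ n M T L γ ρ) (hC₂ : 0 ≤ C₂ n M T L γ ρ)
    (hC₃ : C₃ n M T L γ ρ ≤ 1) {A B Q d G S Δ : ℝ} (hB : 0 ≤ B) (hQ : 0 ≤ Q) (hS : 0 ≤ S)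
    (hdesc : γ * M / (2 * n) * A ≤ Δ - γ * M / (2 * n) * B + γ * M / n * L ^ 2 * (d + Q)
      + L * γ ^ 2 / (2 * n ^ 2) * G)
    (hd : d ≤ γ ^ 2 / n ^ 2 * T ^ 2 * G)
    (hG : G ≤ S + M ^ 2 * (2 * L ^ 2 * Q + B))
    (hdev : Q ≤ γ ^ 2 * (((n : ℝ) - 1) / n) * (1 - √ρ)⁻¹ *
      (S * (1 - √ρ)⁻¹ + (T + (1 - √ρ)⁻¹) * (M ^ 2 * (2 * L ^ 2 * Q + B)))) :
    A ≤ 2 * n / (γ * M) * Δ + 2 * γ * L / (n * M) * S := by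
  have hn' : (1 : ℝ) ≤ n := by exact_mod_cast hn
  have hn0 : (0 : ℝ) < n := by linarith
  have hM' : (0 : ℝ) < M := by exact_mod_cast hM
  have hr0 := Real.sqrt_nonneg ρ
  have hr1 := sqrt_lt_one_of_lt_one hρ₁
  have h3 := bound_of_C₃_le_one hn hL hγ hρ₀ hρ₁ hC₁ hC₃
  have h2 := bound_of_C₂_nonneg hn hM hL hγ hρ₀ hρ₁ hC₁ hC₂
  have hbar := div_sq_le_rhoBar hn hρ₀ hρ₁
  have hv : 1 ≤ (1 - √ρ)⁻¹ := (one_le_inv₀ (by linarith)).2 (by linarith)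
  generalize (1 - √ρ)⁻¹ = v at *
  set R := ((n : ℝ) - 1) / n with hR
  have hR0 : 0 ≤ R := div_nonneg (by linarith) (by linarith)
  set u := γ * M * L with hu
  have hu0 : 0 ≤ u := by positivity
  set a := u * T ^ 2 / n with ha
  have ha0 : 0 ≤ a := by positivity
  set β := u * n * rhoBar n ρ with hβ
  have hβ' : u * n * (R * v ^ 2) ≤ β := mul_le_mul_of_nonneg_left hbar (by positivity)
  -- For `n = 1` there is no deviation: `R = 0`.
  have hε : u ^ 2 * (R * v) * (T + v) ≤ 1 / 10 := by
    rcases Nat.lt_or_ge 1 n with hn2 | hn2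
    · exact feedback_le hn2 hu0 hv hR (by linarith)
    · have : n = 1 := by omega
      have : R = 0 := by rw [hR, this]; simp
      rw [this]
      norm_num
  -- Normalization removing `M` and `L`; `2 * z` is exactly the noise term of the goal.
  set q := L ^ 2 * Q with hq
  have hq0 : 0 ≤ q := by positivity
  set s := S / M ^ 2 with hs
  have hs0 : 0 ≤ s := by positivity
  have hSs : S = M ^ 2 * s := by rw [hs]; field_simp
  set z := u / n * s with hz
  have hz0 : 0 ≤ z := by positivity
  have hqle : q ≤ β * z + 1 / 10 * (2 * q + B) := by
    have h4 : q ≤ L ^ 2 * (γ ^ 2 * R * v * (S * v + (T + v) * (M ^ 2 * (2 * L ^ 2 * Q + B)))) :=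
      mul_le_mul_of_nonneg_left hdev (sq_nonneg L)
    have h5 : L ^ 2 * (γ ^ 2 * R * v * (S * v + (T + v) * (M ^ 2 * (2 * L ^ 2 * Q + B)))) =
        u * n * (R * v ^ 2) * z + u ^ 2 * (R * v) * (T + v) * (2 * q + B) := by
      rw [hSs, hz, hq, hu]
      field_simp
    have h6 := mul_le_mul_of_nonneg_right hβ' hz0
    have h7 := mul_le_mul_of_nonneg_right hε (by positivity : 0 ≤ 2 * q + B)
    linarith
  -- The left side is at most `3 * q + B / 2 + (2 - 4 * β) * z`, and `hqle` gives `3 * q ≤ 15/4 * β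
  -- * z + 3/8 * B`. Both fit; a feedback constant up to `1 / 8` would still do.
  have hmain : 2 * q + u / n * (1 + 2 * a) * (s + (2 * q + B)) ≤ B + 2 * z := by
    have h4 : u / n * (1 + 2 * a) * (2 * q + B) ≤ 1 / 2 * (2 * q + B) :=
      mul_le_mul_of_nonneg_right h2 (by positivity)
    have h5 : u / n * (1 + 2 * a) * s = (1 + 2 * a) * z := by rw [hz]; ring
    have h6 : (1 + 2 * a) * z ≤ (2 - 4 * β) * z :=
      mul_le_mul_of_nonneg_right (by linarith) hz0
    have hβz : 0 ≤ β * z := mul_nonneg (le_trans (by positivity) hβ') hz0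
    rw [mul_add, h5]
    linarith
  have hGs : G ≤ M ^ 2 * (s + (2 * q + B)) := by
    rw [mul_add, ← hSs, hq]
    linarith
  have hscale : A ≤ 2 * n / (γ * M) * (Δ - γ * M / (2 * n) * B + γ * M / n * L ^ 2 * (d + Q)
      + L * γ ^ 2 / (2 * n ^ 2) * G) := by
    have h4 := mul_le_mul_of_nonneg_left hdesc (by positivity : 0 ≤ 2 * n / (γ * M))
    refine le_trans (le_of_eq ?_) h4
    field_simp
  have h4 : 2 * n / (γ * M) * (Δ - γ * M / (2 * n) * B + γ * M / n * L ^ 2 * (d + Q)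
      + L * γ ^ 2 / (2 * n ^ 2) * G) =
      2 * n / (γ * M) * Δ - B + 2 * L ^ 2 * d + 2 * q + L * γ / (n * M) * G := by
    rw [hq]
    field_simp
    ring
  have h5 : 2 * L ^ 2 * d ≤ 2 * L ^ 2 * (γ ^ 2 / n ^ 2 * T ^ 2 * G) :=
    mul_le_mul_of_nonneg_left hd (by positivity)
  have h6 : 2 * L ^ 2 * (γ ^ 2 / n ^ 2 * T ^ 2 * G) + L * γ / (n * M) * G =
      u / n * (1 + 2 * a) / M ^ 2 * G := by
    rw [ha, hu]
    field_simp
    ring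
  have h7 : u / n * (1 + 2 * a) / M ^ 2 * G ≤ u / n * (1 + 2 * a) * (s + (2 * q + B)) := by
    refine (mul_le_mul_of_nonneg_left hGs (by positivity)).trans (le_of_eq ?_)
    field_simp
  have h8 : 2 * γ * L / (n * M) * S = 2 * z := by
    rw [hSs, hz, hu]
    field_simp
  rw [h8]
  linarith

end Constants

/-! ### Descent of the global loss -/

section Descent

variable {n N M : ℕ} {Ξ Ω : Type*} [MeasurableSpace Ξ] {mΩ : MeasurableSpace Ω}
  {P : Measure Ω}
  {p : Fin n → ℝ} {F : Fin n → EuclideanSpace ℝ (Fin N) → Ξ → ℝ} {D : Fin n → Measure Ξ}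
  {L : ℝ≥0} {σ ς ρ γ : ℝ} {τ : ℕ → ℕ}
  {x₀ : Ω → EuclideanSpace ℝ (Fin N)} {w : ℕ → Ω → Fin n}
  {W : ℕ → Ω → Matrix (Fin n) (Fin n) ℝ} {ξ : ℕ → Ω → Fin n → Fin M → Ξ}
  {X : ℕ → Ω → Fin n → EuclideanSpace ℝ (Fin N)}

namespace Run

theorem meanModel_zero (h : Run P p F D L σ ς ρ γ τ x₀ w W ξ X) (ω : Ω) :
    meanModel (X 0 ω) = x₀ ω := by
  have hn : (n : ℝ) ≠ 0 := by exact_mod_cast h.nonempty_workers.ne'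
  simp [meanModel, h.X_zero, ← Nat.cast_smul_eq_nsmul ℝ, smul_smul, hn]

theorem meanModel_succ (h : Run P p F D L σ ς ρ γ τ x₀ w W ξ X) {ω : Ω} {k : ℕ}
    (hW : W k ω ∈ doublyStochastic ℝ (Fin n)) :
    meanModel (X (k + 1) ω) = meanModel (X k ω) + (-(γ / n)) • gradStep F τ w ξ X k ω := by
  have h1 : ∑ i, X (k + 1) ω i = ∑ i, X k ω i - γ • gradStep F τ w ξ X k ω := by
    simp_rw [h.X_succ]
    rw [Finset.sum_sub_distrib, Finset.sum_comm]
    simp_rw [← Finset.sum_smul, sum_row_of_mem_doublyStochastic hW, one_smul]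
    rw [← Finset.smul_sum]
    simp
  rw [meanModel, h1, smul_sub, smul_smul, sub_eq_add_neg, ← neg_smul, meanModel]
  congr 2
  ring

theorem meanModel_sub (h : Run P p F D L σ ς ρ γ τ x₀ w W ξ X) {ω : Ω}
    (hW : ∀ l, W l ω ∈ doublyStochastic ℝ (Fin n)) {j k : ℕ} (hjk : j ≤ k) :
    meanModel (X k ω) - meanModel (X j ω) =
      ∑ l ∈ Finset.Ico j k, (-(γ / n)) • gradStep F τ w ξ X l ω := by
  rw [← Finset.sum_Ico_sub (fun l => meanModel (X l ω)) hjk]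
  refine Finset.sum_congr rfl fun l _ => ?_
  rw [h.meanModel_succ (hW l), add_sub_cancel_left]

variable [IsProbabilityMeasure P]

theorem memLp_meanModel_sub_meanModel (h : Run P p F D L σ ς ρ γ τ x₀ w W ξ X) (j k : ℕ) :
    MemLp (fun ω => meanModel (X k ω) - meanModel (X j ω)) 2 P := by
  have := (h.memLp_meanModel_sub k).sub (h.memLp_meanModel_sub j)
  refine (memLp_congr_ae (Filter.Eventually.of_forall fun ω => ?_)).1 this
  simp

/-- Cauchy–Schwarz over the delay window with unit weights gives one factor `T`; the second comes
from `sum_delay_window_le`. -/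
theorem integral_meanModel_sub_sq_le (h : Run P p F D L σ ς ρ γ τ x₀ w W ξ X) {T : ℕ}
    (hτT : ∀ k, τ k ≤ T) (k : ℕ) :
    ∫ ω, ‖meanModel (X k ω) - meanModel (X (k - τ k) ω)‖ ^ 2 ∂P ≤
      γ ^ 2 / n ^ 2 * T * ∑ j ∈ Finset.Ico (k - τ k) k,
        ∫ ω, ‖gradStep F τ w ξ X j ω‖ ^ 2 ∂P := by
  have h1 := integral_norm_sum_sq_le (P := P) (s := Finset.Ico (k - τ k) k)
    (Y := fun l ω => (-(γ / n)) • gradStep F τ w ξ X l ω)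
    (b := fun j => γ ^ 2 / n ^ 2 * ∫ ω, ‖gradStep F τ w ξ X j ω‖ ^ 2 ∂P) (r := fun _ => 1)
    (fun j _ => (h.memLp_gradStep j).const_smul (-(γ / (n : ℝ)))) (fun j _ => zero_le_one)
    (fun j _ => by
      simp_rw [norm_smul, mul_pow, norm_neg, Real.norm_eq_abs, sq_abs, div_pow]
      rw [integral_const_mul, one_pow, mul_one])
  have h2 : ∀ᵐ ω ∂P, ‖meanModel (X k ω) - meanModel (X (k - τ k) ω)‖ ^ 2 =
      ‖∑ l ∈ Finset.Ico (k - τ k) k, (-(γ / n)) • gradStep F τ w ξ X l ω‖ ^ 2 :=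
    h.ae_doublyStochastic.mono fun ω hω => by rw [h.meanModel_sub hω (Nat.sub_le _ _)]
  rw [integral_congr_ae h2]
  refine h1.trans ?_
  simp only [Finset.sum_const, Nat.card_Ico, nsmul_eq_mul, mul_one]
  rw [← Finset.mul_sum, ← mul_assoc, mul_comm (_ / _) (T : ℝ), mul_assoc, mul_assoc]
  refine mul_le_mul_of_nonneg_right ?_ (mul_nonneg (by positivity)
    (Finset.sum_nonneg fun j _ => integral_nonneg fun ω => sq_nonneg _))
  have := hτT k
  exact_mod_cast (by omega : k - (k - τ k) ≤ T)

/-- The loss lies between its lower bound and its quadratic majorant at the initial model, and both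
are integrable. -/
theorem integrable_globalLoss_meanModel (h : Run P p F D L σ ς ρ γ τ x₀ w W ξ X) (k : ℕ) :
    Integrable (fun ω => globalLoss p F D (meanModel (X k ω))) P := by
  obtain ⟨m, hm⟩ := h.loss.bddBelow
  have hm' : ∀ x, m ≤ globalLoss p F D x := fun x => hm ⟨x, rfl⟩
  have hmeas : Measurable fun ω => globalLoss p F D (meanModel (X k ω)) :=
    h.loss.differentiable_globalLoss.continuous.measurable.comp
      (measurable_meanModel (h.measurable_X k))
  have hd := h.memLp_meanModel_sub k
  have hup : Integrable (fun ω => globalLoss p F D (x₀ ω) +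
      inner ℝ (∇ (globalLoss p F D) (x₀ ω)) (meanModel (X k ω) - x₀ ω) +
      L / 2 * ‖meanModel (X k ω) - x₀ ω‖ ^ 2) P :=
    (h.integrable_init.add (h.memLp_globalGrad_init.integrable_inner_two hd)).add
      (hd.integrable_norm_sq.const_mul _)
  refine integrable_of_le_of_le hmeas.aestronglyMeasurable (Filter.Eventually.of_forall
    fun ω => hm' _) (Filter.Eventually.of_forall fun ω => ?_) (integrable_const m) hup
  have := lipschitz_gradient_upper_bound h.loss.differentiable_globalLoss
    h.loss.lipschitz_gradient_globalLoss (x₀ ω) (meanModel (X k ω) - x₀ ω)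
  rwa [add_sub_cancel] at this

theorem integrable_deviation (h : Run P p F D L σ ς ρ γ τ x₀ w W ξ X) (k : ℕ) :
    Integrable (fun ω => ∑ i, p i * ‖X k ω i - meanModel (X k ω)‖ ^ 2) P :=
  integrable_finsetSum _ fun i _ => (h.memLp_X_sub_meanModel k i).integrable_norm_sq.const_mul _

theorem integral_weighted_deviation_le (h : Run P p F D L σ ς ρ γ τ x₀ w W ξ X) (k : ℕ) :
    ∫ ω, ∑ i, p i * ‖X k ω i - meanModel (X k ω)‖ ^ 2 ∂P ≤
      γ ^ 2 * (((n : ℝ) - 1) / n) * (1 - √ρ)⁻¹ * ∑ j ∈ Finset.range k,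
        (∫ ω, ‖gradStep F τ w ξ X j ω‖ ^ 2 ∂P) * √ρ ^ (k - 1 - j) := by
  rw [integral_finsetSum _ fun i _ => (h.memLp_X_sub_meanModel k i).integrable_norm_sq.const_mul _]
  simp_rw [integral_const_mul]
  refine (Finset.sum_le_sum fun i _ => mul_le_mul_of_nonneg_left (h.integral_deviation_le k i)
    (h.loss.weight_nonneg i)).trans (le_of_eq ?_)
  rw [← Finset.sum_mul, h.loss.weight_sum, one_mul]

theorem integral_gradStep_sq_le (h : Run P p F D L σ ς ρ γ τ x₀ w W ξ X) (k : ℕ) :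
    ∫ ω, ‖gradStep F τ w ξ X k ω‖ ^ 2 ∂P ≤ M * (σ ^ 2 + 6 * M * ς ^ 2) +
      M ^ 2 * (2 * L ^ 2 *
          (∫ ω, ∑ i, p i * ‖X (k - τ k) ω i - meanModel (X (k - τ k) ω)‖ ^ 2 ∂P) +
        ∫ ω, ‖∑ i, p i • ∇ (localLoss F D i) (X (k - τ k) ω i)‖ ^ 2 ∂P) := by
  have hB := (h.memLp_weightedGrad (k - τ k)).integrable_norm_sq
  have hQ := h.integrable_deviation (k - τ k)
  have hint : Integrable (fun ω => M * σ ^ 2 +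
      M ^ 2 * ∑ i, p i * ‖∇ (localLoss F D i) (X (k - τ k) ω i)‖ ^ 2) P :=
    (integrable_const _).add ((integrable_finsetSum _ fun i _ =>
      h.integrable_weight_localGrad_sq_of i (h.measurable_X_apply _ i)
        (h.memLp_X_sub _ i)).const_mul _)
  have hnn : ∀ ω, 0 ≤ M * σ ^ 2 +
      M ^ 2 * ∑ i, p i * ‖∇ (localLoss F D i) (X (k - τ k) ω i)‖ ^ 2 := fun ω =>
    add_nonneg (by positivity) (mul_nonneg (by positivity) (Finset.sum_nonneg fun i _ =>
      mul_nonneg (h.loss.weight_nonneg i) (sq_nonneg _)))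
  have h1 := h.lintegral_gradStep_le k
  rw [← ofReal_integral_norm_sq (h.memLp_gradStep k),
    ← ofReal_integral_eq_lintegral_ofReal hint (Filter.Eventually.of_forall hnn),
    ENNReal.ofReal_le_ofReal_iff (integral_nonneg hnn)] at h1
  refine h1.trans ?_
  calc ∫ ω, M * σ ^ 2 + M ^ 2 * ∑ i, p i * ‖∇ (localLoss F D i) (X (k - τ k) ω i)‖ ^ 2 ∂P
      ≤ ∫ ω, M * (σ ^ 2 + 6 * M * ς ^ 2) + M ^ 2 * (2 * L ^ 2 *
            (∑ i, p i * ‖X (k - τ k) ω i - meanModel (X (k - τ k) ω)‖ ^ 2) +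
          ‖∑ i, p i • ∇ (localLoss F D i) (X (k - τ k) ω i)‖ ^ 2) ∂P := by
        refine integral_mono hint ((integrable_const _).add
          (((hQ.const_mul _).fun_add hB).const_mul _)) fun ω => ?_
        have h2 := mul_le_mul_of_nonneg_left (h.loss.sum_weight_norm_gradient_sq_le
          (X (k - τ k) ω) (meanModel (X (k - τ k) ω))) (sq_nonneg (M : ℝ))
        -- The estimate yields `2 * M² * ς²`; it is relaxed to the `6 * M² * ς²` of the statement.
        have h3 : 0 ≤ (M : ℝ) ^ 2 * ς ^ 2 := by positivity
        beta_reduce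
        linarith
    _ = _ := by
        rw [integral_add (integrable_const _) (((hQ.const_mul _).fun_add hB).const_mul _),
          integral_const_mul ((M : ℝ) ^ 2), integral_add (hQ.const_mul _) hB,
          integral_const_mul (2 * (L : ℝ) ^ 2)]
        simp

/-- The expected global loss decreases along one step, up to error terms. -/
theorem integral_descent (h : Run P p F D L σ ς ρ γ τ x₀ w W ξ X) (hγ : 0 ≤ γ) (k : ℕ) :
    γ * M / (2 * n) * ∫ ω, ‖∇ (globalLoss p F D) (meanModel (X k ω))‖ ^ 2 ∂P ≤
      (∫ ω, globalLoss p F D (meanModel (X k ω)) ∂P) -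
        (∫ ω, globalLoss p F D (meanModel (X (k + 1) ω)) ∂P) -
      γ * M / (2 * n) * (∫ ω, ‖∑ i, p i • ∇ (localLoss F D i) (X (k - τ k) ω i)‖ ^ 2 ∂P) +
      γ * M / n * L ^ 2 *
        ((∫ ω, ‖meanModel (X k ω) - meanModel (X (k - τ k) ω)‖ ^ 2 ∂P) +
          ∫ ω, ∑ i, p i * ‖X (k - τ k) ω i - meanModel (X (k - τ k) ω)‖ ^ 2 ∂P) +
      L * γ ^ 2 / (2 * n ^ 2) * ∫ ω, ‖gradStep F τ w ξ X k ω‖ ^ 2 ∂P := by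
  have hn : (0 : ℝ) < n := by exact_mod_cast h.nonempty_workers
  have hA := h.memLp_globalGrad_meanModel k
  have hB := h.memLp_weightedGrad (k - τ k)
  have hG := h.memLp_gradStep k
  have hQ := h.integrable_deviation (k - τ k)
  have hDm := (h.memLp_meanModel_sub_meanModel (k - τ k) k).integrable_norm_sq
  have hf := h.integrable_globalLoss_meanModel k
  -- The gradient at the current mean is known before step `k`, so the update may be replaced by its
  -- conditional mean.
  have hV : Measurable[past x₀ (stepVars w W ξ) k]
      fun ω => ∇ (globalLoss p F D) (meanModel (X k ω)) :=
    h.measurable_globalGrad.comp (measurable_meanModel (h.measurable_past_X le_rfl))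
  have hinner := h.integral_inner_gradStep hV hA hG
  have hstep : ∫ ω, globalLoss p F D (meanModel (X (k + 1) ω)) ∂P ≤
      (∫ ω, globalLoss p F D (meanModel (X k ω)) ∂P) +
      -(γ / n) * (∫ ω, inner ℝ (∇ (globalLoss p F D) (meanModel (X k ω)))
        (gradStep F τ w ξ X k ω) ∂P) +
      L * γ ^ 2 / (2 * n ^ 2) * ∫ ω, ‖gradStep F τ w ξ X k ω‖ ^ 2 ∂P := by
    have hi := (hA.integrable_inner_two hG).const_mul (-(γ / n))
    have hg := hG.integrable_norm_sq.const_mul (L * γ ^ 2 / (2 * n ^ 2))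
    rw [← integral_const_mul, ← integral_const_mul, ← integral_add hf hi,
      ← integral_add (hf.fun_add hi) hg]
    refine integral_mono_ae (h.integrable_globalLoss_meanModel (k + 1)) ((hf.fun_add hi).fun_add hg) ?_
    filter_upwards [h.sampling.doublyStochastic k] with ω hω
    rw [h.meanModel_succ hω]
    refine (lipschitz_gradient_upper_bound h.loss.differentiable_globalLoss
      h.loss.lipschitz_gradient_globalLoss _ _).trans (le_of_eq ?_)
    rw [inner_smul_right, norm_smul, mul_pow, norm_neg, Real.norm_eq_abs, sq_abs]
    field_simp
  -- Polarization of the inner product; half of the squared bias is at most `L²` times the drift of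
  -- the mean plus the deviation.
  have hlow : (1 / 2 : ℝ) * (∫ ω, ‖∇ (globalLoss p F D) (meanModel (X k ω))‖ ^ 2 ∂P) +
      1 / 2 * (∫ ω, ‖∑ i, p i • ∇ (localLoss F D i) (X (k - τ k) ω i)‖ ^ 2 ∂P) -
      L ^ 2 * ((∫ ω, ‖meanModel (X k ω) - meanModel (X (k - τ k) ω)‖ ^ 2 ∂P) +
          ∫ ω, ∑ i, p i * ‖X (k - τ k) ω i - meanModel (X (k - τ k) ω)‖ ^ 2 ∂P) ≤
      ∫ ω, inner ℝ (∇ (globalLoss p F D) (meanModel (X k ω)))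
        (∑ i, p i • ∇ (localLoss F D i) (X (k - τ k) ω i)) ∂P := by
    have hA2 := hA.integrable_norm_sq.const_mul (1 / 2 : ℝ)
    have hB2 := hB.integrable_norm_sq.const_mul (1 / 2 : ℝ)
    have hE := (hDm.fun_add hQ).const_mul ((L : ℝ) ^ 2)
    rw [← integral_add hDm hQ, ← integral_const_mul, ← integral_const_mul, ← integral_const_mul,
      ← integral_add hA2 hB2, ← integral_sub (hA2.fun_add hB2) hE]
    refine integral_mono ((hA2.fun_add hB2).sub hE) (hA.integrable_inner_two hB) fun ω => ?_
    have h1 := h.loss.norm_gradient_globalLoss_sub_sum_sq_le (X (k - τ k) ω) (meanModel (X k ω))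
      (meanModel (X (k - τ k) ω))
    rw [norm_sub_sq_real] at h1
    beta_reduce
    linarith
  rw [hinner] at hstep
  have h2 := mul_le_mul_of_nonneg_left hlow (by positivity : 0 ≤ γ / n * M)
  have h3 : γ * M / (2 * n) = γ / n * M * (1 / 2) := by field_simp
  have h4 : γ * M / n = γ / n * M := by ring
  rw [h3, h4]
  linarith

end Run

end Descent

end ADPSGD

end

/-! ### Summation over the steps and conclusion -/

theorem theorem1 {n N M T K : ℕ} {Ξ Ω : Type*} [MeasurableSpace Ξ] [MeasurableSpace Ω]
    (P : Measure Ω) [IsProbabilityMeasure P]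
    (p : Fin n → ℝ) (F : Fin n → EuclideanSpace ℝ (Fin N) → Ξ → ℝ) (D : Fin n → Measure Ξ)
    (L : ℝ≥0) (σ ς ρ γ : ℝ) (τ : ℕ → ℕ)
    (x₀ : Ω → EuclideanSpace ℝ (Fin N)) (w : ℕ → Ω → Fin n)
    (W : ℕ → Ω → Matrix (Fin n) (Fin n) ℝ) (ξ : ℕ → Ω → Fin n → Fin M → Ξ)
    (X : ℕ → Ω → Fin n → EuclideanSpace ℝ (Fin N))
    (hM : 1 ≤ M) (hK : 1 ≤ K) (hγ : 0 < γ) (hρ₀ : 0 ≤ ρ) (hρ₁ : ρ < 1)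
    (hloss : ADPSGD.LossAssumptions p F D L σ ς)
    (hsamp : ADPSGD.SamplingAssumptions P p D ρ x₀ w W ξ)
    (hinit : Integrable (fun ω => ADPSGD.globalLoss p F D (x₀ ω)) P)
    (hτ : ∀ k, τ k ≤ k) (hτT : ∀ k, τ k ≤ T)
    (hX : ∀ k ω, X k ω =
      ADPSGD.iterate F γ τ (x₀ ω) (fun l => w l ω) (fun l => W l ω) (fun l => ξ l ω) k)
    (hC₁ : 0 < ADPSGD.C₁ n M T L γ ρ)
    (hC₂ : 0 ≤ ADPSGD.C₂ n M T L γ ρ)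
    (hC₃ : ADPSGD.C₃ n M T L γ ρ ≤ 1) :
    (∀ k, Integrable
      (fun ω => ‖∇ (ADPSGD.globalLoss p F D) (ADPSGD.meanModel (X k ω))‖ ^ 2) P) ∧
    (∑ k ∈ Finset.range K,
        ∫ ω, ‖∇ (ADPSGD.globalLoss p F D) (ADPSGD.meanModel (X k ω))‖ ^ 2 ∂P) / K
      ≤ 2 * ((∫ ω, ADPSGD.globalLoss p F D (x₀ ω) ∂P) - (⨅ x, ADPSGD.globalLoss p F D x)) * n
            / (γ * K * M)
        + 2 * γ * L / n * (σ ^ 2 + 6 * M * ς ^ 2) := by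
  have h : ADPSGD.Run P p F D L σ ς ρ γ τ x₀ w W ξ X :=
    ⟨hρ₀, hρ₁, hloss, hsamp, hinit, hτ, hX⟩
  refine ⟨fun k => (h.memLp_globalGrad_meanModel k).integrable_norm_sq, ?_⟩
  have hn := h.nonempty_workers
  have hK' : (0 : ℝ) < K := by exact_mod_cast hK
  have hM' : (0 : ℝ) < M := by exact_mod_cast hM
  have hn' : (0 : ℝ) < n := by exact_mod_cast hn
  set A : ℕ → ℝ := fun k =>
    ∫ ω, ‖∇ (ADPSGD.globalLoss p F D) (ADPSGD.meanModel (X k ω))‖ ^ 2 ∂P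
  set B : ℕ → ℝ := fun k =>
    ∫ ω, ‖∑ i, p i • ∇ (ADPSGD.localLoss F D i) (X (k - τ k) ω i)‖ ^ 2 ∂P
  set Q : ℕ → ℝ := fun k =>
    ∫ ω, ∑ i, p i * ‖X (k - τ k) ω i - ADPSGD.meanModel (X (k - τ k) ω)‖ ^ 2 ∂P
  set d : ℕ → ℝ := fun k =>
    ∫ ω, ‖ADPSGD.meanModel (X k ω) - ADPSGD.meanModel (X (k - τ k) ω)‖ ^ 2 ∂P
  set G : ℕ → ℝ := fun k => ∫ ω, ‖ADPSGD.gradStep F τ w ξ X k ω‖ ^ 2 ∂P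
  set f : ℕ → ℝ := fun k => ∫ ω, ADPSGD.globalLoss p F D (ADPSGD.meanModel (X k ω)) ∂P
  set s : ℝ := M * (σ ^ 2 + 6 * M * ς ^ 2) with hs
  have hB0 : ∀ k, 0 ≤ B k := fun k => integral_nonneg fun ω => sq_nonneg _
  have hG0 : ∀ k, 0 ≤ G k := fun k => integral_nonneg fun ω => sq_nonneg _
  have hQ0 : ∀ k, 0 ≤ Q k := fun k => integral_nonneg fun ω =>
    Finset.sum_nonneg fun i _ => mul_nonneg (hloss.weight_nonneg i) (sq_nonneg _)
  have hs0 : 0 ≤ s := by positivity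
  have hf0 : f 0 = ∫ ω, ADPSGD.globalLoss p F D (x₀ ω) ∂P :=
    integral_congr_ae (Filter.Eventually.of_forall fun ω => by
      beta_reduce
      rw [h.meanModel_zero])
  have hfK : ⨅ x, ADPSGD.globalLoss p F D x ≤ f K := by
    have h1 := integral_mono (μ := P) (integrable_const (⨅ x, ADPSGD.globalLoss p F D x))
      (h.integrable_globalLoss_meanModel K) fun ω => ciInf_le hloss.bddBelow _
    simpa using h1
  have hsum := ADPSGD.sum_sq_gradient_le_of_bounds (n := n) (M := M) (T := T) (L := L) (γ := γ)
    (ρ := ρ) (A := ∑ k ∈ Finset.range K, A k) (B := ∑ k ∈ Finset.range K, B k)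
    (Q := ∑ k ∈ Finset.range K, Q k) (d := ∑ k ∈ Finset.range K, d k)
    (G := ∑ k ∈ Finset.range K, G k) (S := K * s) (Δ := f 0 - f K) hn hM L.2 hγ hρ₀ hρ₁ hC₁ hC₂ hC₃
    (Finset.sum_nonneg fun k _ => hB0 k) (Finset.sum_nonneg fun k _ => hQ0 k) (by positivity)
    (by
      have h1 := Finset.sum_le_sum fun k (_ : k ∈ Finset.range K) => h.integral_descent hγ.le k
      simp only [Finset.sum_add_distrib, Finset.sum_sub_distrib, ← Finset.mul_sum] at h1
      rw [← Finset.sum_sub_distrib, Finset.sum_range_sub'] at h1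
      exact h1)
    (by
      refine (Finset.sum_le_sum fun k _ => h.integral_meanModel_sub_sq_le hτT k).trans ?_
      rw [← Finset.mul_sum]
      refine (mul_le_mul_of_nonneg_left (ADPSGD.sum_delay_window_le hG0 hτT K)
        (by positivity)).trans (le_of_eq ?_)
      ring)
    (by
      have h1 : ∀ k, G k ≤ s + M ^ 2 * (2 * L ^ 2 * Q k + B k) := h.integral_gradStep_sq_le
      refine (Finset.sum_le_sum fun k _ => h1 k).trans (le_of_eq ?_)
      simp only [Finset.sum_add_distrib, ← Finset.mul_sum, Finset.sum_const, Finset.card_range,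
        nsmul_eq_mul])
    (by
      have hr1 := ADPSGD.sqrt_lt_one_of_lt_one hρ₁
      have hn1 : (0 : ℝ) ≤ n - 1 := by
        have : (1 : ℝ) ≤ n := by exact_mod_cast hn
        linarith
      -- `Q k` is the deviation at the stale time `k - τ k`, so the discounted sums end there.
      refine (Finset.sum_le_sum fun k _ => h.integral_weighted_deviation_le (k - τ k)).trans ?_
      rw [← Finset.mul_sum]
      have h1 := ADPSGD.sum_delay_discounted_le hs0
        (e := fun k => M ^ 2 * (2 * L ^ 2 * Q k + B k))
        (fun k => by have := hQ0 k; have := hB0 k; positivity) h.integral_gradStep_sq_le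
        (Real.sqrt_nonneg ρ) hr1 hτT K
      simp only [← Finset.mul_sum, Finset.sum_add_distrib] at h1
      refine mul_le_mul_of_nonneg_left h1 ?_
      have : 0 < 1 - √ρ := by linarith
      positivity)
  rw [div_le_iff₀ hK']
  refine hsum.trans ?_
  have h1 : 2 * (n : ℝ) / (γ * M) * (f 0 - f K) ≤
      2 * n / (γ * M) * (f 0 - ⨅ x, ADPSGD.globalLoss p F D x) :=
    mul_le_mul_of_nonneg_left (by linarith) (by positivity)
  refine (add_le_add_left h1 _).trans (le_of_eq ?_)
  rw [hf0, hs]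
  field_simp
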